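/- Let $\pi:Y\to X$ be a smooth fibre bundle (more generally, a surjective submersion) of finite-dimensional Hausdorff second-countable smooth manifolds, $n=\dim X$, with fibred coordinates $(x^\lambda,y^i)$, jet bundle $J^1Y$ with coordinates $(x^\lambda,y^i,y^i_\lambda)$, and Legendre bundle $\Pi=\bigwedge^nT^*X\otimes_YV^*Y\otimes_YTX$ with coordinates $(x^\lambda,y^i,p^\lambda_i)$ and projection $\pi_{\Pi Y}:\Pi\to Y$. Put $\omega=dx^1\wedge\dots\wedge dx^n$, $\omega_\lambda=\partial_\lambda\rfloor\omega$. Let $L=\mathcal L\,\omega:J^1Y\to\bigwedge^nT^*X$ be a quadratic Lagrangian, $$\mathcal L=\tfrac12a^{\lambda\mu}_{ij}y^i_\lambda y^j_\mu+b^\lambda_iy^i_\lambda+c,$$ with $a$ (symmetric), $b$, $c$ smooth local functions on $Y$ and $a$ of constant rank. Let $\widehat L:J^1Y\to\Pi$, $p^\lambda_i\circ\widehat L=a^{\lambda\mu}_{ij}y^j_\mu+b^\lambda_i$, be its Legendre map, $\overline L:T^*X\otimes_YVY\to\Pi$, $p^\lambda_i\circ\overline L=a^{\lambda\mu}_{ij}\overline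 y^j_\mu$, the corresponding linear morphism, $N_L=\widehat L(J^1Y)$ the Lagrangian constraint space, and $\mathrm{Ker}\,\widehat L=\widehat L^{-1}(0)$; assume that $N_L$ contains the zero section of $\Pi\to Y$. Fix a smooth linear bundle map $\sigma:\Pi\to T^*X\otimes_YVY$ over $Y$ with $\overline L\circ\sigma|_{N_L}=\mathrm{id}_{N_L}$. For a connection $\Gamma$ on $Y\to X$ (a smooth global section of $J^1Y\to Y$) with values in $\mathrm{Ker}\,\widehat L$, i.e. $a^{\lambda\mu}_{ij}\Gamma^j_\mu+b^\lambda_i=0$, put $\Phi_{\sigma\Gamma}=\Gamma\circ\pi_{\Pi Y}+\sigma:\Pi\to J^1Y$ and $$H_{\sigma\Gamma}=H_{\Phi_{\sigma\Gamma}}+\Phi_{\sigma\Gamma}^*L,\qquad H_\Phi=p^\lambda_i\,dy^i\wedge\omega_\lambda-p^\lambda_i\Phi^i_\lambda\,\omega .$$ Then the Hamiltonian forms $H_{\sigma\Gamma}$, with $\Gamma$ ranging over all such connections, form a complete set of Hamiltonian forms weakly associated with $L$. That is: (1) every $H=H_{\sigma\Gamma}$ is a Hamiltonian form, $H=p^\lambda_i\,dy^i\wedge\omega_\lambda-\mathcal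 H\,\omega$ with $\mathcal H$ smooth, and it is weakly associated with $L$: its Hamiltonian map $\widehat H:\Pi\to J^1Y$, $y^i_\lambda\circ\widehat H=\partial\mathcal H/\partial p^\lambda_i$, satisfies $\widehat L\circ\widehat H\circ\widehat L=\widehat L$, and $H=H_{\widehat H}+\widehat H^*L$ at the points of $N_L$; (2) for every global smooth section $s$ of $Y\to X$ that solves the Euler–Lagrange equations of $L$ there are such a connection $\Gamma$ and a global smooth section $r$ of $\Pi\to X$ that solves the covariant Hamilton equations $\partial_\lambda y^i=\partial\mathcal H/\partial p^\lambda_i$, $\partial_\lambda p^\lambda_i=-\partial\mathcal H/\partial y^i$ of $H_{\sigma\Gamma}=p^\lambda_i\,dy^i\wedge\omega_\lambda-\mathcal H\,\omega$, such that $s=\pi_{\Pi Y}\circ r$. -/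

import Mathlib

open scoped Manifold ContDiff Topology

set_option maxSynthPendingDepth 3

noncomputable section

namespace Polysymplectic

/-- The model space of a `k`-dimensional manifold. By definition it is also Mathlib's
`TangentSpace` at every point of a manifold modelled on it. -/
abbrev E (k : ℕ) : Type := EuclideanSpace ℝ (Fin k)

/-- Coordinate velocities `(y^i_λ)`: linear maps from the base directions to the fibre directions. -/
abbrev Vel (n m : ℕ) : Type := E n →L[ℝ] E m

/-- Coordinate momenta `(p^λ_i)`, written as the functional `(y^i_λ) ↦ ∑ p^λ_i y^i_λ`. -/
abbrev CoMom (n m : ℕ) : Type := Vel n m →L[ℝ] ℝ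

/-- The elementary velocity `dx^l ⊗ w`. -/
def elemVel {n m : ℕ} (l : Fin n) (w : E m) : Vel n m :=
  (EuclideanSpace.proj l : E n →L[ℝ] ℝ).smulRight w

/-- The divergence `∂_l (p^l_i w^i)` at `z` of a field of coordinate momenta. -/
def divergence {n m : ℕ} (P : E n → CoMom n m) (z : E n) (w : E m) : ℝ :=
  ∑ l : Fin n, fderiv ℝ (fun z' => P z' (elemVel l w)) z (EuclideanSpace.single l 1)

section

variable {n m : ℕ} {X Y : Type*}
  [TopologicalSpace X] [ChartedSpace (E n) X]
  [TopologicalSpace Y] [ChartedSpace (E n × E m) Y]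

/-- Fibred coordinates `(x^λ, y^i)` for `f : Y → X`: smooth charts of `Y` and of `X` such that
`f` reads `(x, y) ↦ x`. -/
structure FibredChart (n m : ℕ) {X Y : Type*} [TopologicalSpace X] [ChartedSpace (E n) X]
    [TopologicalSpace Y] [ChartedSpace (E n × E m) Y] (f : Y → X) where
  base : OpenPartialHomeomorph X (E n)
  total : OpenPartialHomeomorph Y (E n × E m)
  base_mem : base ∈ IsManifold.maximalAtlas 𝓘(ℝ, E n) ∞ X
  total_mem : total ∈ IsManifold.maximalAtlas 𝓘(ℝ, E n × E m) ∞ Y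
  proj_mem : ∀ y ∈ total.source, f y ∈ base.source
  fst_total : ∀ y ∈ total.source, (total y).1 = base (f y)

/-- A fibred manifold `Y → X` (a surjective submersion) with `n`-dimensional base and
`m`-dimensional fibres: a map of `Y` onto `X` with fibred coordinates around every point of `Y`.
Every smooth fibre bundle is one. -/
structure FibredManifold (n m : ℕ) (X Y : Type*) [TopologicalSpace X] [ChartedSpace (E n) X]
    [TopologicalSpace Y] [ChartedSpace (E n × E m) Y] where
  proj : Y → X
  surjective : Function.Surjective proj
  exists_chart : ∀ y : Y, ∃ c : FibredChart n m proj, y ∈ c.total.source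

/-- The tangent map `T_y Y → T_{π y} X`. -/
def dproj (π : FibredManifold n m X Y) (y : Y) : E n × E m →L[ℝ] E n :=
  mfderiv 𝓘(ℝ, E n × E m) 𝓘(ℝ, E n) π.proj y

/-- The vertical tangent space `V_y Y`. -/
abbrev Vert (π : FibredManifold n m X Y) (y : Y) : Submodule ℝ (E n × E m) :=
  LinearMap.ker (dproj π y).toLinearMap

/-- The fibre of `T^*X ⊗ VY` at `y`. -/
abbrev Sold (π : FibredManifold n m X Y) (y : Y) : Type := E n →L[ℝ] Vert π y

/-- The fibre `⋀ⁿ T^*_x X`, `n = dim X`. -/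
abbrev Dens (n : ℕ) : Type := E n [⋀^Fin n]→L[ℝ] ℝ

/-- The fibre of the jet bundle `J¹Y → Y` at `y`: the right inverses `T_{π y} X → T_y Y` of the
tangent map of `π`. -/
def Jet (π : FibredManifold n m X Y) (y : Y) : Type :=
  {v : E n →L[ℝ] E n × E m // (dproj π y).comp v = ContinuousLinearMap.id ℝ (E n)}

/-- The fibre at `y` of the Legendre bundle `Π = ⋀ⁿ T^*X ⊗ V^*Y ⊗ TX`, as
`Hom (T^*X ⊗ VY, ⋀ⁿ T^*X)`. -/
abbrev Mom (π : FibredManifold n m X Y) (y : Y) : Type := Sold π y →L[ℝ] Dens n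

/-- The Legendre bundle. -/
abbrev LegendreBundle (π : FibredManifold n m X Y) : Type _ := Σ y : Y, Mom π y

/-- The affine structure of `J¹Y → Y`: a jet plus an element of `T^*X ⊗ VY`. -/
def Jet.add {π : FibredManifold n m X Y} {y : Y} (v : Jet π y) (w : Sold π y) : Jet π y :=
  ⟨v.1 + (Vert π y).subtypeL.comp w, by
    ext1 e
    have h1 := DFunLike.congr_fun v.2 e
    have h2 : dproj π y ((w e : Vert π y) : E n × E m) = 0 := (w e).2
    simpa [h2] using h1⟩

/-- The difference of two jets at the same point. -/
def Jet.sub {π : FibredManifold n m X Y} {y : Y} (v v' : Jet π y) : Sold π y :=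
  (v.1 - v'.1).codRestrict (Vert π y) (by
    intro e
    have h1 := DFunLike.congr_fun v.2 e
    have h2 := DFunLike.congr_fun v'.2 e
    simp only [ContinuousLinearMap.comp_apply] at h1 h2
    simp [LinearMap.mem_ker, map_sub, h1, h2])

namespace FibredChart

variable {π : FibredManifold n m X Y} (c : FibredChart n m π.proj)

/-- The tangent map of the chart of `Y`. -/
def dtotal (y : Y) : E n × E m →L[ℝ] E n × E m :=
  mfderiv 𝓘(ℝ, E n × E m) 𝓘(ℝ, E n × E m) c.total y

/-- The inverse of the tangent map of the chart of `X` at `x`; it sends the standard basis to the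
coordinate vectors `∂_λ`. -/
def dbaseInv (x : X) : E n →L[ℝ] E n :=
  mfderiv 𝓘(ℝ, E n) 𝓘(ℝ, E n) c.base.symm (c.base x)

/-- The coordinate frame `(∂_1, …, ∂_n)` of `T_x X`. -/
def frame (x : X) : Fin n → E n := fun l => c.dbaseInv x (EuclideanSpace.single l 1)

/-- The coordinates `y^i_λ` of a jet. -/
def jetCoord {y : Y} (v : Jet π y) : Vel n m :=
  (ContinuousLinearMap.snd ℝ (E n) (E m)).comp
    ((c.dtotal y).comp (v.1.comp (c.dbaseInv (π.proj y))))

/-- The coordinates of an element of `T^*X ⊗ VY`. -/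
def soldCoord {y : Y} (w : Sold π y) : Vel n m :=
  (ContinuousLinearMap.snd ℝ (E n) (E m)).comp
    ((c.dtotal y).comp (((Vert π y).subtypeL.comp w).comp (c.dbaseInv (π.proj y))))

/-- `P` are the coordinates `p^λ_i` of `p`: `p(w) = p^λ_i w^i_λ ω` with
`ω = dx^1 ∧ … ∧ dx^n`. -/
def IsMomCoord {y : Y} (p : Mom π y) (P : CoMom n m) : Prop :=
  ∀ w : Sold π y, p w (c.frame (π.proj y)) = P (c.soldCoord w)

/-- The coordinate expression `x ↦ (y^i(x))` of a map `s : X → Y`. -/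
def localRep (s : X → Y) : E n → E m := fun z => (c.total (s (c.base.symm z))).2

end FibredChart

/-! ### Lagrangians -/

/-- A first-order Lagrangian `L : J¹Y → ⋀ⁿ T^*X` (smoothness is imposed separately). -/
abbrev Lagrangian (π : FibredManifold n m X Y) : Type _ := ∀ y : Y, Jet π y → Dens n

/-- `ℓ` is the coordinate expression of `L` : `L = ℓ(x^λ, y^i, y^i_λ) ω`. -/
def Lagrangian.IsCoordExpr {π : FibredManifold n m X Y} (L : Lagrangian π) (c : FibredChart n m π.proj)
    (ℓ : E n × E m → Vel n m → ℝ) : Prop :=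
  ∀ y ∈ c.total.source, ∀ v : Jet π y,
    L y v (c.frame (π.proj y)) = ℓ (c.total y) (c.jetCoord v)

/-- `L` is a smooth quadratic Lagrangian: in all fibred coordinates,
`L = (1/2 a^{λμ}_{ij} y^i_λ y^j_μ + b^λ_i y^i_λ + c) ω` with smooth functions `a`, `b`, `c` of
`(x^λ, y^i)` and `a` symmetric. -/
def Lagrangian.IsQuadratic {π : FibredManifold n m X Y} (L : Lagrangian π) : Prop :=
  ∀ c : FibredChart n m π.proj,
    ∃ (a : E n × E m → Vel n m →L[ℝ] Vel n m →L[ℝ] ℝ) (b : E n × E m → CoMom n m)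
      (c₀ : E n × E m → ℝ),
      ContDiffOn ℝ ∞ a c.total.target ∧ ContDiffOn ℝ ∞ b c.total.target ∧
      ContDiffOn ℝ ∞ c₀ c.total.target ∧
      (∀ z ∈ c.total.target, ∀ A B, a z A B = a z B A) ∧
      L.IsCoordExpr c (fun z A => 1 / 2 * a z A A + b z A + c₀ z)

/-- The Legendre map `L̂ : J¹Y → Π`, `p^λ_i = ∂ℓ / ∂y^i_λ`: the derivative along the fibres. -/
def Lagrangian.legendre {π : FibredManifold n m X Y} (L : Lagrangian π) (y : Y) (v : Jet π y) : Mom π y :=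
  fderiv ℝ (fun w : Sold π y => L y (v.add w)) 0

/-- The linear morphism `T^*X ⊗ VY → Π` given by the derivative of the Legendre map along the
fibres at the jet `v`; for a quadratic Lagrangian it is `p^λ_i = a^{λμ}_{ij} y^j_μ` and does not
depend on `v`. -/
def Lagrangian.legendreLin {π : FibredManifold n m X Y} (L : Lagrangian π) (y : Y) (v : Jet π y) :
    Sold π y →L[ℝ] Mom π y :=
  fderiv ℝ (fun w : Sold π y => L.legendre y (v.add w)) 0

/-- The fibre at `y` of the Lagrangian constraint space `N_L = L̂(J¹Y)`. -/
def Lagrangian.constraintSpace {π : FibredManifold n m X Y} (L : Lagrangian π) (y : Y) : Set (Mom π y) :=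
  Set.range (L.legendre y)

/-- Almost regularity of a quadratic Lagrangian: the matrix function `a` has constant rank. -/
def Lagrangian.HasConstantRank {π : FibredManifold n m X Y} (L : Lagrangian π) : Prop :=
  ∃ k : ℕ, ∀ (y : Y) (v : Jet π y),
    Module.finrank ℝ (LinearMap.range (L.legendreLin y v).toLinearMap) = k

/-- A (global, smooth) section of `π`. -/
def IsSmoothSection (π : FibredManifold n m X Y) (s : X → Y) : Prop :=
  ContMDiff 𝓘(ℝ, E n) 𝓘(ℝ, E n × E m) ∞ s ∧ ∀ x, π.proj (s x) = x

/-- The section `s` solves the Euler–Lagrange equations `∂_i ℓ - d_λ (∂ℓ / ∂y^i_λ) = 0`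
(in all fibred coordinates). -/
def Lagrangian.IsEulerLagrangeSolution {π : FibredManifold n m X Y} (L : Lagrangian π) (s : X → Y) : Prop :=
  IsSmoothSection π s ∧
  ∀ (c : FibredChart n m π.proj) (ℓ : E n × E m → Vel n m → ℝ), L.IsCoordExpr c ℓ →
    ∀ x : X, s x ∈ c.total.source → ∀ w : E m,
      fderiv ℝ (fun u => ℓ (c.base x, u) (fderiv ℝ (c.localRep s) (c.base x)))
          (c.localRep s (c.base x)) w
        = divergence (fun z => fderiv ℝ (ℓ (z, c.localRep s z)) (fderiv ℝ (c.localRep s) z))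
            (c.base x) w

/-! ### Hamiltonian forms -/

/-- A family of functions `v ↦ H(p, v)` on the fibres of `J¹Y`, with `p` in the Legendre bundle.
A Hamiltonian form `H = p^λ_i dy^i ∧ ω_λ - 𝓗 ω` is encoded by its pull-back by jets,
`H(p, v) = (p^λ_i y^i_λ - 𝓗(p)) ω`, which determines it: the fibre of `Z_Y = T^*Y ∧ ⋀ⁿ⁻¹ T^*X`
is thereby the space of affine maps from the fibre of `J¹Y` to `⋀ⁿ T^*X`. -/
abbrev PreHamiltonianForm (π : FibredManifold n m X Y) : Type _ := ∀ y : Y, Mom π y → Jet π y → Dens n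

/-- In the given fibred coordinates `H = p^λ_i dy^i ∧ ω_λ - 𝓗(x^λ, y^i, p^λ_i) ω`. -/
def PreHamiltonianForm.IsCoordExpr {π : FibredManifold n m X Y} (H : PreHamiltonianForm π) (c : FibredChart n m π.proj)
    (𝓗 : E n × E m → CoMom n m → ℝ) : Prop :=
  ∀ y ∈ c.total.source, ∀ (p : Mom π y) (P : CoMom n m), c.IsMomCoord p P → ∀ v : Jet π y,
    H y p v (c.frame (π.proj y)) = P (c.jetCoord v) - 𝓗 (c.total y) P

/-- `H` is a Hamiltonian form: in all fibred coordinates it is `p^λ_i dy^i ∧ ω_λ - 𝓗 ω` with a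
smooth function `𝓗`. -/
def IsHamiltonianForm {π : FibredManifold n m X Y} (H : PreHamiltonianForm π) : Prop :=
  ∀ c : FibredChart n m π.proj, ∃ 𝓗 : E n × E m → CoMom n m → ℝ,
    ContDiffOn ℝ ∞ (Function.uncurry 𝓗) (c.total.target ×ˢ Set.univ) ∧ H.IsCoordExpr c 𝓗

/-- `Φ` is the Hamiltonian map `Ĥ : Π → J¹Y` of `H`, `y^i_λ ∘ Ĥ = ∂𝓗 / ∂p^λ_i`. -/
def IsHamiltonianMapOf {π : FibredManifold n m X Y} (H : PreHamiltonianForm π)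
    (Φ : ∀ y : Y, Mom π y → Jet π y) : Prop :=
  ∀ (c : FibredChart n m π.proj) (𝓗 : E n × E m → CoMom n m → ℝ), H.IsCoordExpr c 𝓗 →
    ∀ y ∈ c.total.source, ∀ (p : Mom π y) (P : CoMom n m), c.IsMomCoord p P →
      ∀ Q : CoMom n m, fderiv ℝ (𝓗 (c.total y)) P Q = Q (c.jetCoord (Φ y p))

/-- The form `H_Φ + Φ^*L` of a bundle map `Φ : Π → J¹Y`, where
`H_Φ = p^λ_i dy^i ∧ ω_λ - p^λ_i Φ^i_λ ω`. -/
def formOfMap {π : FibredManifold n m X Y} (L : Lagrangian π) (Φ : ∀ y : Y, Mom π y → Jet π y) :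
    PreHamiltonianForm π :=
  fun y p v => p (v.sub (Φ y p)) + L y (Φ y p)

/-- `H` is weakly associated with `L`: `L̂ ∘ Ĥ ∘ L̂ = L̂`, and `H = H_Ĥ + Ĥ^*L` on the Lagrangian
constraint space. -/
def IsWeaklyAssociated {π : FibredManifold n m X Y} (L : Lagrangian π) (H : PreHamiltonianForm π) : Prop :=
  IsHamiltonianForm H ∧ ∃ Φ : ∀ y : Y, Mom π y → Jet π y, IsHamiltonianMapOf H Φ ∧
    (∀ (y : Y) (v : Jet π y), L.legendre y (Φ y (L.legendre y v)) = L.legendre y v) ∧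
    ∀ (y : Y), ∀ p ∈ L.constraintSpace y, H y p = formOfMap L Φ y p

/-- `P` is the coordinate expression `x ↦ (p^λ_i(x))` of a map `r : X → Π`. -/
def FibredChart.IsMomRep {π : FibredManifold n m X Y} (c : FibredChart n m π.proj) (r : X → LegendreBundle π)
    (P : E n → CoMom n m) : Prop :=
  ∀ x : X, (r x).1 ∈ c.total.source → c.IsMomCoord (r x).2 (P (c.base x))

/-- A (global, smooth) section of the Legendre bundle `Π → X`. -/
def IsSmoothLegendreSection {π : FibredManifold n m X Y} (r : X → LegendreBundle π) : Prop :=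
  IsSmoothSection π (fun x => (r x).1) ∧
  ∀ c : FibredChart n m π.proj, ∃ P : E n → CoMom n m,
    ContDiffOn ℝ ∞ P (c.base '' {x | (r x).1 ∈ c.total.source}) ∧ c.IsMomRep r P

/-- The section `r` of `Π → X` solves the covariant Hamilton equations
`∂_λ y^i = ∂𝓗 / ∂p^λ_i`, `∂_λ p^λ_i = - ∂𝓗 / ∂y^i` (in all fibred coordinates). -/
def IsHamiltonSolution {π : FibredManifold n m X Y} (H : PreHamiltonianForm π) (r : X → LegendreBundle π) : Prop :=
  IsSmoothLegendreSection r ∧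
  ∀ (c : FibredChart n m π.proj) (𝓗 : E n × E m → CoMom n m → ℝ) (P : E n → CoMom n m),
    H.IsCoordExpr c 𝓗 → c.IsMomRep r P → ∀ x : X, (r x).1 ∈ c.total.source →
      (∀ Q : CoMom n m,
        fderiv ℝ (𝓗 (c.total (r x).1)) (P (c.base x)) Q
          = Q (fderiv ℝ (c.localRep (fun x' => (r x').1)) (c.base x))) ∧
      (∀ w : E m,
        divergence P (c.base x) w
          = - fderiv ℝ (fun u => 𝓗 (c.base x, u) (P (c.base x))) (c.total (r x).1).2 w)

/-- A set of Hamiltonian forms weakly associated with `L` is complete if every solution of the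
Euler–Lagrange equations is the projection to `Y` of a solution of the Hamilton equations for some
form of the set. -/
def IsCompleteSet {π : FibredManifold n m X Y} (L : Lagrangian π) (S : Set (PreHamiltonianForm π)) : Prop :=
  (∀ H ∈ S, IsWeaklyAssociated L H) ∧
  ∀ s : X → Y, L.IsEulerLagrangeSolution s →
    ∃ H ∈ S, ∃ r : X → LegendreBundle π, IsHamiltonSolution H r ∧ ∀ x, s x = (r x).1

/-! ### Connections and the forms `H_{σΓ}` -/

/-- `Γ` is a connection on `Y → X`: a smooth section of `J¹Y → Y`. -/
def IsConnection {π : FibredManifold n m X Y} (Γ : ∀ y : Y, Jet π y) : Prop :=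
  ∀ c : FibredChart n m π.proj,
    ContDiffOn ℝ ∞ (fun z => c.jetCoord (Γ (c.total.symm z))) c.total.target

/-- A smooth linear bundle map `σ : Π → T^*X ⊗ VY` over `Y`, `y^i_λ = σ^{ij}_{λμ} p^μ_j`. -/
def IsSmoothBundleMap {π : FibredManifold n m X Y} (σ : ∀ y : Y, Mom π y →L[ℝ] Sold π y) : Prop :=
  ∀ c : FibredChart n m π.proj, ∃ S : E n × E m → CoMom n m →L[ℝ] Vel n m,
    ContDiffOn ℝ ∞ S c.total.target ∧
    ∀ y ∈ c.total.source, ∀ (p : Mom π y) (P : CoMom n m), c.IsMomCoord p P →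
      c.soldCoord (σ y p) = S (c.total y) P

/-- `L̄ ∘ σ = id` on the Lagrangian constraint space, where `L̄` is the linear morphism defined by
the Legendre map. -/
def IsSectionOnConstraints {π : FibredManifold n m X Y} (L : Lagrangian π)
    (σ : ∀ y : Y, Mom π y →L[ℝ] Sold π y) : Prop :=
  ∀ (y : Y) (v : Jet π y), ∀ p ∈ L.constraintSpace y, L.legendreLin y v (σ y p) = p

/-- The affine map `Φ_{σΓ} = Γ + σ : Π → J¹Y`. -/
def mapOf {π : FibredManifold n m X Y} (σ : ∀ y : Y, Mom π y →L[ℝ] Sold π y) (Γ : ∀ y : Y, Jet π y) :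
    ∀ y : Y, Mom π y → Jet π y :=
  fun y p => (Γ y).add (σ y p)

/-- The Hamiltonian form `H_{σΓ} = H_Φ + Φ^*L` with `Φ = Φ_{σΓ}`. -/
def hamForm {π : FibredManifold n m X Y} (L : Lagrangian π) (σ : ∀ y : Y, Mom π y →L[ℝ] Sold π y)
    (Γ : ∀ y : Y, Jet π y) : PreHamiltonianForm π :=
  formOfMap L (mapOf σ Γ)

end

end Polysymplectic

end

/-!
The proof works fibrewise and in fibred coordinates. Over a point of `Y` a quadratic Lagrangian
satisfies `L̂(v + w) = L̂(v) + L̄(w)`, so for a connection `Γ` in `Ker L̂` the map `Φ = Γ + σ`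
satisfies `L̂(Φ(p)) = L̄(σ(p)) = p` for every `p` in the constraint space `N_L`
(`IsSectionOnConstraints.legendre_mapOf`).

*Weak association.* In coordinates `H_{σΓ}` has the Hamiltonian `𝓗(z, P) = P(Φ) - ℓ(z, Φ)` with
`Φ = Γ(z) + S(z) P` (`hamForm_isCoordExpr`), hence
`∂𝓗/∂P = Φ + Sᵀ(P - ∂ℓ/∂A(Φ))` (`hasFDerivAt_coordHam`). The Hamiltonian map of `H_{σΓ}` is therefore
`p ↦ Φ(p) + σᵀ(p - L̂(Φ(p)))`, with the transpose furnished by the reflexivity of the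
finite-dimensional fibres (`exists_transpose`). On `N_L` the correction vanishes, so the Hamiltonian
map is `Φ` there, and both conditions of weak association follow (`isWeaklyAssociated_hamForm`).

*Completeness.* Given a solution `s` of the Euler–Lagrange equations, the jet prolongation `J¹s`,
defined on the closed subset `s(X)` of `Y`, is extended to a connection `Γ` by a partition of unity
(`exists_connection_extending`); the fibres of `J¹Y → Y` are affine, so jets may be averaged. The
connection `Γ - σ(L̂ Γ)` takes values in `Ker L̂`, and adding `σ` to it sends `L̂(J¹s)` back to `J¹s`
(`legendre_kerConnection`, `mapOf_kerConnection`). For `r = L̂ ∘ J¹s` the first Hamilton equation says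
that `Φ(r) = J¹s`. The second one is the Euler–Lagrange equation: as `P = ∂ℓ/∂A` along `r`, the
variation of `Φ` drops out of `∂𝓗/∂y`, and `∂𝓗/∂y = -∂ℓ/∂y`
(`fderiv_envelope`, `isHamiltonSolution_legendreSection`).
-/

noncomputable section

namespace Polysymplectic

variable {n m : ℕ} {X Y : Type*}
  [TopologicalSpace X] [ChartedSpace (E n) X]
  [TopologicalSpace Y] [ChartedSpace (E n × E m) Y]
  {π : FibredManifold n m X Y}

/-! ### Fibred coordinates on jets and momenta -/

namespace FibredChart

variable (c : FibredChart n m π.proj)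

lemma mdifferentiable_base : c.base.MDifferentiable 𝓘(ℝ, E n) 𝓘(ℝ, E n) :=
  ⟨(contMDiffOn_of_mem_maximalAtlas c.base_mem).mdifferentiableOn (by simp),
    (contMDiffOn_symm_of_mem_maximalAtlas c.base_mem).mdifferentiableOn (by simp)⟩

lemma mdifferentiable_total :
    c.total.MDifferentiable 𝓘(ℝ, E n × E m) 𝓘(ℝ, E n × E m) :=
  ⟨(contMDiffOn_of_mem_maximalAtlas c.total_mem).mdifferentiableOn (by simp),
    (contMDiffOn_symm_of_mem_maximalAtlas c.total_mem).mdifferentiableOn (by simp)⟩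

/-- The tangent map of the chart of `X`. -/
def dbase (x : X) : E n →L[ℝ] E n := mfderiv 𝓘(ℝ, E n) 𝓘(ℝ, E n) c.base x

/-- The inverse of the tangent map of the chart of `Y`. -/
def dtotalInv (y : Y) : E n × E m →L[ℝ] E n × E m :=
  mfderiv 𝓘(ℝ, E n × E m) 𝓘(ℝ, E n × E m) c.total.symm (c.total y)

variable {c}

lemma dbaseInv_dbase {x : X} (hx : x ∈ c.base.source) (e : E n) :
    c.dbaseInv x (c.dbase x e) = e :=
  DFunLike.congr_fun (c.mdifferentiable_base.symm_comp_deriv hx) e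

lemma dbase_dbaseInv {x : X} (hx : x ∈ c.base.source) (e : E n) :
    c.dbase x (c.dbaseInv x e) = e := by
  have h := c.mdifferentiable_base.comp_symm_deriv (c.base.map_source hx)
  rw [c.base.left_inv hx] at h
  exact DFunLike.congr_fun h e

lemma dtotalInv_dtotal {y : Y} (hy : y ∈ c.total.source) (e : E n × E m) :
    c.dtotalInv y (c.dtotal y e) = e :=
  DFunLike.congr_fun (c.mdifferentiable_total.symm_comp_deriv hy) e

lemma dtotal_dtotalInv {y : Y} (hy : y ∈ c.total.source) (e : E n × E m) :
    c.dtotal y (c.dtotalInv y e) = e := by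
  have h := c.mdifferentiable_total.comp_symm_deriv (c.total.map_source hy)
  rw [c.total.left_inv hy] at h
  exact DFunLike.congr_fun h e

lemma proj_eventuallyEq {y : Y} (hy : y ∈ c.total.source) :
    π.proj =ᶠ[𝓝 y] fun y' => c.base.symm (c.total y').1 := by
  filter_upwards [c.total.open_source.mem_nhds hy] with y' hy'
  rw [c.fst_total y' hy', c.base.left_inv (c.proj_mem y' hy')]

/-- The tangent map of `π` is the projection `(x, y) ↦ x` in fibred coordinates. -/
lemma dproj_eq {y : Y} (hy : y ∈ c.total.source) (e : E n × E m) :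
    dproj π y e = c.dbaseInv (π.proj y) (c.dtotal y e).1 := by
  have ht := c.mdifferentiable_total.mdifferentiableAt hy
  have hb : MDifferentiableAt 𝓘(ℝ, E n) 𝓘(ℝ, E n) c.base.symm (c.total y).1 := by
    rw [c.fst_total y hy]
    exact c.mdifferentiable_base.mdifferentiableAt_symm (c.base.map_source (c.proj_mem y hy))
  have hf : HasMFDerivAt 𝓘(ℝ, E n × E m) 𝓘(ℝ, E n) (Prod.fst : E n × E m → E n) (c.total y)
      (ContinuousLinearMap.fst ℝ (E n) (E m)) := hasFDerivAt_fst.hasMFDerivAt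
  have h := (hb.hasMFDerivAt.comp y (hf.comp y ht.hasMFDerivAt)).congr_of_eventuallyEq
    (proj_eventuallyEq hy)
  have h2 := h.mfderiv
  have h3 := DFunLike.congr_fun h2 e
  refine h3.trans ?_
  change mfderiv 𝓘(ℝ, E n) 𝓘(ℝ, E n) c.base.symm (c.total y).1 (c.dtotal y e).1 = _
  rw [c.fst_total y hy]
  rfl

lemma fst_dtotal {y : Y} (hy : y ∈ c.total.source) (e : E n × E m) :
    (c.dtotal y e).1 = c.dbase (π.proj y) (dproj π y e) := by
  rw [dproj_eq hy, dbase_dbaseInv (c.proj_mem y hy)]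

/-- A jet in fibred coordinates: `∂_λ ↦ ∂_λ + y^i_λ ∂_i`. -/
lemma dtotal_jet {y : Y} (hy : y ∈ c.total.source) (v : Jet π y) (e : E n) :
    c.dtotal y (v.1 (c.dbaseInv (π.proj y) e)) = (e, c.jetCoord v e) := by
  refine Prod.ext ?_ rfl
  have h := DFunLike.congr_fun v.2 (c.dbaseInv (π.proj y) e)
  simp only [ContinuousLinearMap.comp_apply, ContinuousLinearMap.id_apply] at h
  rw [fst_dtotal hy, h, dbase_dbaseInv (c.proj_mem y hy)]

lemma dtotal_sold {y : Y} (hy : y ∈ c.total.source) (w : Sold π y) (e : E n) :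
    c.dtotal y (w (c.dbaseInv (π.proj y) e)) = (0, c.soldCoord w e) := by
  refine Prod.ext ?_ rfl
  have h : dproj π y (w (c.dbaseInv (π.proj y) e) : E n × E m) = 0 :=
    (w (c.dbaseInv (π.proj y) e)).2
  rw [fst_dtotal hy, h, map_zero]

lemma jet_eq_of_coord {y : Y} (hy : y ∈ c.total.source) (v : Jet π y) (e : E n) :
    v.1 e = c.dtotalInv y (c.dbase (π.proj y) e, c.jetCoord v (c.dbase (π.proj y) e)) := by
  rw [← dtotal_jet hy, dbaseInv_dbase (c.proj_mem y hy), dtotalInv_dtotal hy]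

lemma jetCoord_injective {y : Y} (hy : y ∈ c.total.source) :
    Function.Injective (c.jetCoord : Jet π y → Vel n m) := by
  intro v v' h
  refine Subtype.ext (ContinuousLinearMap.ext fun e => ?_)
  rw [jet_eq_of_coord hy, jet_eq_of_coord hy, h]

/-- The jet at `y` with coordinates `A`. -/
def jetOfCoord {y : Y} (hy : y ∈ c.total.source) (A : Vel n m) : Jet π y :=
  ⟨(c.dtotalInv y).comp (((ContinuousLinearMap.id ℝ (E n)).prod A).comp (c.dbase (π.proj y))), by
    ext1 e
    simp [dproj_eq hy, dtotal_dtotalInv hy, dbaseInv_dbase (c.proj_mem y hy)]⟩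

@[simp] lemma jetCoord_jetOfCoord {y : Y} (hy : y ∈ c.total.source) (A : Vel n m) :
    c.jetCoord (jetOfCoord hy A : Jet π y) = A := by
  ext1 e
  simp [jetCoord, jetOfCoord, dtotal_dtotalInv hy, dbase_dbaseInv (c.proj_mem y hy)]

/-- The fibre coordinates on `T^*X ⊗ VY` as a linear equivalence. -/
def soldEquiv {y : Y} (hy : y ∈ c.total.source) : Sold π y ≃ₗ[ℝ] Vel n m where
  toFun := c.soldCoord
  map_add' w w' := by ext1 e; simp [soldCoord]
  map_smul' r w := by ext1 e; simp [soldCoord]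
  invFun A := ((c.dtotalInv y).comp (((0 : E n →L[ℝ] E n).prod A).comp
    (c.dbase (π.proj y)))).codRestrict (Vert π y) (fun e => by
      simp [dproj_eq hy, dtotal_dtotalInv hy])
  left_inv w := by
    ext1 e
    refine Subtype.ext ?_
    change c.dtotalInv y (0, c.soldCoord w (c.dbase (π.proj y) e)) = (w e : E n × E m)
    rw [← dtotal_sold hy, dbaseInv_dbase (c.proj_mem y hy), dtotalInv_dtotal hy]
  right_inv A := by
    ext1 e
    change (c.dtotal y (c.dtotalInv y (0, A (c.dbase (π.proj y)
      (c.dbaseInv (π.proj y) e))))).2 = _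
    rw [dtotal_dtotalInv hy, dbase_dbaseInv (c.proj_mem y hy)]

/-- The fibre coordinates on `T^*X ⊗ VY` as a continuous linear map. -/
def soldCoordL {y : Y} (hy : y ∈ c.total.source) : Sold π y →L[ℝ] Vel n m :=
  LinearMap.toContinuousLinearMap (soldEquiv hy).toLinearMap

@[simp] lemma soldCoordL_apply {y : Y} (hy : y ∈ c.total.source) (w : Sold π y) :
    soldCoordL hy w = c.soldCoord w := rfl

lemma soldCoord_surjective {y : Y} (hy : y ∈ c.total.source) :
    Function.Surjective (c.soldCoord : Sold π y → Vel n m) := (soldEquiv hy).surjective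

lemma jetCoord_add {y : Y} (v : Jet π y) (w : Sold π y) :
    c.jetCoord (v.add w) = c.jetCoord v + c.soldCoord w := by
  ext1 e; simp [jetCoord, soldCoord, Jet.add]

lemma soldCoord_sub {y : Y} (v v' : Jet π y) :
    c.soldCoord (v.sub v') = c.jetCoord v - c.jetCoord v' := by
  ext1 e
  change (c.dtotal y ((v.1 - v'.1) (c.dbaseInv (π.proj y) e))).2 = _
  simp [jetCoord]

/-- The frame `∂_λ` as a basis of the tangent space. -/
lemma exists_frame_basis {x : X} (hx : x ∈ c.base.source) :
    ∃ b : Module.Basis (Fin n) ℝ (E n), ⇑b = c.frame x := by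
  let e : E n ≃ₗ[ℝ] E n :=
    { (c.dbaseInv x).toLinearMap with
      invFun := c.dbase x
      left_inv := dbase_dbaseInv hx
      right_inv := dbaseInv_dbase hx }
  refine ⟨(EuclideanSpace.basisFun (Fin n) ℝ).toBasis.map e, ?_⟩
  ext1 l
  simp [frame, e]

/-- An `n`-form at a point is determined by its value on the coordinate frame. -/
lemma dens_ext {x : X} (hx : x ∈ c.base.source) {η η' : Dens n}
    (h : η (c.frame x) = η' (c.frame x)) : η = η' := by
  obtain ⟨b, hb⟩ := c.exists_frame_basis hx
  rw [← hb] at h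
  apply ContinuousAlternatingMap.toAlternatingMap_injective
  rw [AlternatingMap.eq_smul_basis_det b η.toAlternatingMap,
    AlternatingMap.eq_smul_basis_det b η'.toAlternatingMap]
  congr 1

lemma exists_vol {x : X} (hx : x ∈ c.base.source) : ∃ η : Dens n, η (c.frame x) = 1 := by
  obtain ⟨b, hb⟩ := c.exists_frame_basis hx
  have hc : Continuous fun v : Fin n → E n => b.det v := by
    simp only [Module.Basis.det_apply]
    refine Continuous.matrix_det (continuous_matrix fun i j => ?_)
    exact (b.coord i).continuous_of_finiteDimensional.comp (continuous_apply j)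
  refine ⟨⟨⟨b.det.toMultilinearMap, hc⟩, b.det.map_eq_zero_of_eq'⟩, ?_⟩
  rw [← hb]
  exact b.det_self

/-- The form `ω = dx^1 ∧ … ∧ dx^n` at a point of the chart. -/
def vol {x : X} (hx : x ∈ c.base.source) : Dens n := (exists_vol hx).choose

@[simp] lemma vol_frame {x : X} (hx : x ∈ c.base.source) : vol hx (c.frame x) = 1 :=
  (exists_vol hx).choose_spec

/-- The momentum at `y` with coordinates `P`, linear in `P`. -/
def momOfCoord {y : Y} (hy : y ∈ c.total.source) : CoMom n m →L[ℝ] Mom π y :=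
  (ContinuousLinearMap.compL ℝ (Sold π y) ℝ (Dens n)
      ((ContinuousLinearMap.id ℝ ℝ).smulRight (vol (c.proj_mem y hy)))).comp
    ((ContinuousLinearMap.compL ℝ (Sold π y) (Vel n m) ℝ).flip (soldCoordL hy))

@[simp] lemma momOfCoord_apply {y : Y} (hy : y ∈ c.total.source) (P : CoMom n m) (w : Sold π y) :
    (momOfCoord hy P : Mom π y) w = P (c.soldCoord w) • vol (c.proj_mem y hy) := by
  simp [momOfCoord]

/-- As `⋀ⁿ T^*X` has one-dimensional fibres, a momentum is determined by its coordinates. -/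
lemma isMomCoord_iff {y : Y} (hy : y ∈ c.total.source) {p : Mom π y} {P : CoMom n m} :
    c.IsMomCoord p P ↔ p = momOfCoord hy P := by
  constructor
  · intro h
    ext1 w
    refine dens_ext (c.proj_mem y hy) ?_
    rw [h w]
    simp
  · rintro rfl w
    simp

lemma isMomCoord_momOfCoord {y : Y} (hy : y ∈ c.total.source) (P : CoMom n m) :
    c.IsMomCoord (momOfCoord hy P : Mom π y) P := (isMomCoord_iff hy).2 rfl

lemma exists_isMomCoord {y : Y} (hy : y ∈ c.total.source) (p : Mom π y) :
    ∃ P : CoMom n m, c.IsMomCoord p P := by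
  refine ⟨LinearMap.toContinuousLinearMap
    { toFun := fun A => p ((soldEquiv hy).symm A) (c.frame (π.proj y))
      map_add' := by simp
      map_smul' := by simp }, fun w => ?_⟩
  change _ = p ((soldEquiv hy).symm (soldEquiv hy w)) _
  simp

lemma IsMomCoord.unique {y : Y} (hy : y ∈ c.total.source) {p : Mom π y} {P P' : CoMom n m}
    (h : c.IsMomCoord p P) (h' : c.IsMomCoord p P') : P = P' := by
  ext1 A
  obtain ⟨w, rfl⟩ := c.soldCoord_surjective hy A
  rw [← h w, ← h' w]

end FibredChart

/-! ### The Legendre map in coordinates -/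

variable {c c' : FibredChart n m π.proj}

open FibredChart

lemma fderiv_clm_add_const {U V : Type*} [NormedAddCommGroup U] [NormedSpace ℝ U]
    [NormedAddCommGroup V] [NormedSpace ℝ V] (T : U →L[ℝ] V) (v : V) (u : U) :
    fderiv ℝ (fun u => T u + v) u = T :=
  (T.hasFDerivAt.add_const v).fderiv

namespace Lagrangian

variable {L : Lagrangian π}

lemma IsCoordExpr.eq_smul_vol {ℓ : E n × E m → Vel n m → ℝ} (hℓ : L.IsCoordExpr c ℓ) {y : Y}
    (hy : y ∈ c.total.source) (v : Jet π y) :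
    L y v = ℓ (c.total y) (c.jetCoord v) • vol (c.proj_mem y hy) := by
  refine dens_ext (c.proj_mem y hy) ?_
  rw [hℓ y hy v]
  simp

/-- The Legendre map in fibred coordinates: `p^λ_i = ∂ℓ / ∂y^i_λ`. -/
lemma IsCoordExpr.isMomCoord_legendre {ℓ : E n × E m → Vel n m → ℝ} (hℓ : L.IsCoordExpr c ℓ)
    {y : Y} (hy : y ∈ c.total.source) {v : Jet π y} {P : CoMom n m}
    (hP : HasFDerivAt (ℓ (c.total y)) P (c.jetCoord v)) :
    c.IsMomCoord (L.legendre y v) P := by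
  rw [isMomCoord_iff hy]
  have h0 : HasFDerivAt (fun w : Sold π y => c.jetCoord v + soldCoordL hy w) (soldCoordL hy) 0 :=
    (soldCoordL hy).hasFDerivAt.const_add _
  have h1 : HasFDerivAt (ℓ (c.total y)) P (c.jetCoord v + soldCoordL hy (0 : Sold π y)) := by
    rwa [map_zero, add_zero]
  have h2 := ((h1.comp (0 : Sold π y) h0).smul_const (vol (c.proj_mem y hy)))
  have h3 : (fun w : Sold π y => L y (v.add w))
      = fun w => (ℓ (c.total y) ∘ fun w : Sold π y => c.jetCoord v + soldCoordL hy w) w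
        • vol (c.proj_mem y hy) := by
    ext1 w
    rw [hℓ.eq_smul_vol hy, jetCoord_add]
    rfl
  unfold legendre
  rw [h3, h2.fderiv]
  ext1 w
  simp

/-- The coordinate expression `1/2 a^{λμ}_{ij} y^i_λ y^j_μ + b^λ_i y^i_λ + c` of a quadratic
Lagrangian, with smooth coefficients and symmetric `a`. -/
structure IsQuadraticExpr (L : Lagrangian π) (c : FibredChart n m π.proj)
    (a : E n × E m → Vel n m →L[ℝ] Vel n m →L[ℝ] ℝ) (b : E n × E m → CoMom n m)
    (c₀ : E n × E m → ℝ) : Prop where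
  contDiffOn_a : ContDiffOn ℝ ∞ a c.total.target
  contDiffOn_b : ContDiffOn ℝ ∞ b c.total.target
  contDiffOn_c₀ : ContDiffOn ℝ ∞ c₀ c.total.target
  symm : ∀ z ∈ c.total.target, ∀ A B, a z A B = a z B A
  isCoordExpr : L.IsCoordExpr c (fun z A => 1 / 2 * a z A A + b z A + c₀ z)

lemma IsQuadratic.exists_isQuadraticExpr (hL : L.IsQuadratic) (c : FibredChart n m π.proj) :
    ∃ a b c₀, L.IsQuadraticExpr c a b c₀ := by
  obtain ⟨a, b, c₀, h1, h2, h3, h4, h5⟩ := hL c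
  exact ⟨a, b, c₀, h1, h2, h3, h4, h5⟩

namespace IsQuadraticExpr

variable {a : E n × E m → Vel n m →L[ℝ] Vel n m →L[ℝ] ℝ} {b : E n × E m → CoMom n m}
  {c₀ : E n × E m → ℝ}

lemma hasFDerivAt (h : L.IsQuadraticExpr c a b c₀) {z : E n × E m} (hz : z ∈ c.total.target)
    (A : Vel n m) :
    HasFDerivAt (fun A => 1 / 2 * a z A A + b z A + c₀ z) (a z A + b z) A := by
  have h1 := (((a z).hasFDerivAt (x := A)).clm_apply (hasFDerivAt_id A)).const_mul (1 / 2)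
  refine ((h1.add (b z).hasFDerivAt).add_const (c₀ z)).congr_fderiv ?_
  ext1 B
  simp [h.symm z hz B A]
  ring

lemma isMomCoord_legendre (h : L.IsQuadraticExpr c a b c₀) {y : Y} (hy : y ∈ c.total.source)
    (v : Jet π y) :
    c.IsMomCoord (L.legendre y v) (a (c.total y) (c.jetCoord v) + b (c.total y)) :=
  h.isCoordExpr.isMomCoord_legendre hy (h.hasFDerivAt (c.total.map_source hy) _)

set_option synthInstance.maxHeartbeats 200000 in
/-- The linear morphism `L̄` is `p^λ_i = a^{λμ}_{ij} y^j_μ`; it does not depend on the jet `v`. -/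
lemma legendreLin_apply (h : L.IsQuadraticExpr c a b c₀) {y : Y} (hy : y ∈ c.total.source)
    (v : Jet π y) (w : Sold π y) :
    L.legendreLin y v w = momOfCoord hy (a (c.total y) (c.soldCoord w)) := by
  have h1 : (fun w : Sold π y => L.legendre y (v.add w)) = fun w =>
      (momOfCoord hy).comp ((a (c.total y)).comp (soldCoordL hy)) w
        + momOfCoord hy (a (c.total y) (c.jetCoord v) + b (c.total y)) := by
    ext1 w
    rw [(isMomCoord_iff hy).1 (h.isMomCoord_legendre hy (v.add w)), jetCoord_add]
    simp only [map_add, ContinuousLinearMap.comp_apply, soldCoordL_apply]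
    abel
  unfold legendreLin
  rw [h1]
  exact DFunLike.congr_fun (fderiv_clm_add_const _ _ _) w

/-- The quadratic Lagrangian is smooth in all the coordinates of the jet bundle. -/
lemma contDiffOn (h : L.IsQuadraticExpr c a b c₀) :
    ContDiffOn ℝ ∞ (fun q : (E n × E m) × Vel n m => 1 / 2 * a q.1 q.2 q.2 + b q.1 q.2 + c₀ q.1)
      (c.total.target ×ˢ Set.univ) := by
  have hfst : ContDiffOn ℝ ∞ (fun q : (E n × E m) × Vel n m => q.1)
    (c.total.target ×ˢ Set.univ) := contDiffOn_fst
  have hsnd : ContDiffOn ℝ ∞ (fun q : (E n × E m) × Vel n m => q.2)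
    (c.total.target ×ˢ Set.univ) := contDiffOn_snd
  have hm : Set.MapsTo (fun q : (E n × E m) × Vel n m => q.1)
    (c.total.target ×ˢ Set.univ) c.total.target := fun q hq => hq.1
  exact ((contDiffOn_const.mul (((h.contDiffOn_a.comp hfst hm).clm_apply hsnd).clm_apply hsnd)).add
    ((h.contDiffOn_b.comp hfst hm).clm_apply hsnd)).add (h.contDiffOn_c₀.comp hfst hm)

end IsQuadraticExpr

set_option synthInstance.maxHeartbeats 200000 in
/-- For a quadratic Lagrangian, `L̂ (v + w) = L̂ v + L̄ w`. -/
lemma IsQuadratic.legendre_add (hL : L.IsQuadratic) {y : Y} (v v' : Jet π y) (w : Sold π y) :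
    L.legendre y (v.add w) = L.legendre y v + L.legendreLin y v' w := by
  obtain ⟨c, hy⟩ := π.exists_chart y
  obtain ⟨a, b, c₀, h⟩ := hL.exists_isQuadraticExpr c
  rw [h.legendreLin_apply hy, (isMomCoord_iff hy).1 (h.isMomCoord_legendre hy (v.add w)),
    (isMomCoord_iff hy).1 (h.isMomCoord_legendre hy v), jetCoord_add]
  simp only [map_add]
  abel

end Lagrangian

/-! ### Hamiltonian forms in coordinates -/

/-- The function `𝓗 = p^λ_i F^i_λ - ℓ(F)` of the form `H_Φ + Φ^*L`, where `F` is the coordinate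
expression of `Φ` and `ℓ` that of `L`. -/
def coordHam (ℓ : E n × E m → Vel n m → ℝ) (F : E n × E m → CoMom n m → Vel n m)
    (z : E n × E m) (P : CoMom n m) : ℝ :=
  P (F z P) - ℓ z (F z P)

lemma formOfMap_isCoordExpr {L : Lagrangian π} {ℓ : E n × E m → Vel n m → ℝ}
    (hℓ : L.IsCoordExpr c ℓ) {Φ : ∀ y : Y, Mom π y → Jet π y}
    {F : E n × E m → CoMom n m → Vel n m}
    (hF : ∀ y ∈ c.total.source, ∀ (p : Mom π y) (P : CoMom n m), c.IsMomCoord p P →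
      c.jetCoord (Φ y p) = F (c.total y) P) :
    (formOfMap L Φ).IsCoordExpr c (coordHam ℓ F) := by
  intro y hy p P hP v
  simp only [formOfMap, ContinuousAlternatingMap.add_apply, hP _, hℓ y hy, soldCoord_sub,
    hF y hy p P hP, coordHam, map_sub]
  ring

/-- The Hamiltonian `𝓗` of a form is determined on the domain of the coordinates, since every value of
`P` is attained there and every fibre of `J¹Y` is nonempty. -/
lemma PreHamiltonianForm.IsCoordExpr.unique {H : PreHamiltonianForm π}
    {𝓗 𝓗' : E n × E m → CoMom n m → ℝ} (h : H.IsCoordExpr c 𝓗) (h' : H.IsCoordExpr c 𝓗')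
    {z : E n × E m} (hz : z ∈ c.total.target) : 𝓗 z = 𝓗' z := by
  ext1 P
  have hy := c.total.map_target hz
  have e1 := h _ hy _ P (isMomCoord_momOfCoord hy P) (jetOfCoord hy 0)
  have e2 := h' _ hy _ P (isMomCoord_momOfCoord hy P) (jetOfCoord hy 0)
  rw [c.total.right_inv hz] at e1 e2
  linarith

/-- The derivative of `𝓗 = p F - ℓ(F)`, `F = G + S p`, along the momenta. -/
lemma hasFDerivAt_coordHam {ℓ : E n × E m → Vel n m → ℝ} {G : E n × E m → Vel n m}
    {S : E n × E m → CoMom n m →L[ℝ] Vel n m} {z : E n × E m} {P P' : CoMom n m}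
    (hℓ : HasFDerivAt (ℓ z) P' (G z + S z P)) :
    HasFDerivAt (coordHam ℓ (fun z P => G z + S z P) z)
      (ContinuousLinearMap.apply ℝ ℝ (G z + S z P) + (P - P').comp (S z)) P := by
  have hF : HasFDerivAt (fun P => G z + S z P) (S z) P := (S z).hasFDerivAt.const_add _
  refine (((hasFDerivAt_id P).clm_apply hF).sub (hℓ.comp P hF)).congr_fderiv ?_
  ext1 Q
  simp
  ring

/-- The envelope argument: if `P` is the derivative of `ℓ(u₀, ·)` at `Φ(u₀)`, then the derivative of
`u ↦ P(Φ(u)) - ℓ(u, Φ(u))` at `u₀` does not see the variation of `Φ`. -/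
lemma fderiv_envelope {U V : Type*} [NormedAddCommGroup U] [NormedSpace ℝ U]
    [NormedAddCommGroup V] [NormedSpace ℝ V] {ℓ : U → V → ℝ} {Φ : U → V} {u₀ : U} {P : V →L[ℝ] ℝ}
    (hℓ : DifferentiableAt ℝ (Function.uncurry ℓ) (u₀, Φ u₀)) (hΦ : DifferentiableAt ℝ Φ u₀)
    (hP : HasFDerivAt (ℓ u₀) P (Φ u₀)) :
    fderiv ℝ (fun u => P (Φ u) - ℓ u (Φ u)) u₀ = - fderiv ℝ (fun u => ℓ u (Φ u₀)) u₀ := by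
  set D := fderiv ℝ (Function.uncurry ℓ) (u₀, Φ u₀)
  have hD : HasFDerivAt (Function.uncurry ℓ) D (u₀, Φ u₀) := hℓ.hasFDerivAt
  have h1 : HasFDerivAt (fun u => ℓ u (Φ u)) (D.comp ((ContinuousLinearMap.id ℝ U).prod
      (fderiv ℝ Φ u₀))) u₀ :=
    HasFDerivAt.comp (f := fun u => (u, Φ u)) u₀ hD ((hasFDerivAt_id u₀).prodMk hΦ.hasFDerivAt)
  have h2 : HasFDerivAt (fun u => ℓ u (Φ u₀)) (D.comp ((ContinuousLinearMap.id ℝ U).prod 0)) u₀ :=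
    HasFDerivAt.comp (f := fun u => (u, Φ u₀)) u₀ hD
      ((hasFDerivAt_id u₀).prodMk (hasFDerivAt_const _ _))
  have h3 : HasFDerivAt (ℓ u₀) (D.comp ((0 : V →L[ℝ] U).prod (ContinuousLinearMap.id ℝ V)))
      (Φ u₀) :=
    HasFDerivAt.comp (f := fun v => (u₀, v)) (Φ u₀) hD
      ((hasFDerivAt_const _ _).prodMk (hasFDerivAt_id _))
  have h0 : HasFDerivAt (fun u => P (Φ u)) (P.comp (fderiv ℝ Φ u₀)) u₀ :=
    P.hasFDerivAt.comp u₀ hΦ.hasFDerivAt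
  have h01 : HasFDerivAt (fun u => P (Φ u) - ℓ u (Φ u)) _ u₀ := h0.sub h1
  rw [h01.fderiv, h2.fderiv]
  ext1 w
  have h4 := DFunLike.congr_fun (hP.unique h3) (fderiv ℝ Φ u₀ w)
  simp only [ContinuousLinearMap.comp_apply, ContinuousLinearMap.prod_apply,
    zero_apply, ContinuousLinearMap.id_apply, sub_apply,
    neg_apply] at h4 ⊢
  have h5 : D (w, fderiv ℝ Φ u₀ w) = D (w, 0) + D (0, fderiv ℝ Φ u₀ w) := by
    rw [← map_add]; simp
  rw [h5, h4]
  ring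

set_option synthInstance.maxHeartbeats 200000 in
/-- The transpose of `σ`: an element `p'` of `Π` and a linear map `σ : Π → T^*X ⊗ VY` give the
functional `q ↦ p'(σ q)`, which is the evaluation at an element of `T^*X ⊗ VY`. -/
lemma exists_transpose {y : Y} (σ : Mom π y →L[ℝ] Sold π y) (p' : Mom π y) :
    ∃ w : Sold π y, ∀ q : Mom π y, q w = p' (σ q) := by
  obtain ⟨c, hy⟩ := π.exists_chart y
  -- In coordinates this is the reflexivity of the finite-dimensional space of velocities.
  let f : Module.Dual ℝ (Module.Dual ℝ (Vel n m)) :=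
    { toFun := fun Q => p' (σ (momOfCoord hy (LinearMap.toContinuousLinearMap Q)))
        (c.frame (π.proj y))
      map_add' := by simp
      map_smul' := by simp }
  obtain ⟨w, hw⟩ := c.soldCoord_surjective hy ((Module.evalEquiv ℝ (Vel n m)).symm f)
  refine ⟨w, fun q => dens_ext (c.proj_mem y hy) ?_⟩
  obtain ⟨Q, hQ⟩ := exists_isMomCoord hy q
  rw [hQ w, hw]
  have h1 : (Q : Vel n m →ₗ[ℝ] ℝ) ((Module.evalEquiv ℝ (Vel n m)).symm f) = f Q :=
    Module.apply_evalEquiv_symm_apply _ _ _ _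
  refine h1.trans ?_
  rw [(isMomCoord_iff hy).1 hQ]
  rfl

/-! ### Weak association of `H_{σΓ}` with `L` -/

section Weak

variable {L : Lagrangian π} {σ : ∀ y : Y, Mom π y →L[ℝ] Sold π y} {Γ : ∀ y : Y, Jet π y}

/-- The map `Φ = Γ + σ` is a section of the Legendre map over the constraint space. -/
lemma IsSectionOnConstraints.legendre_mapOf (hL : L.IsQuadratic)
    (hσL : IsSectionOnConstraints L σ) (hΓ : ∀ y, L.legendre y (Γ y) = 0) {y : Y} {p : Mom π y}
    (hp : p ∈ L.constraintSpace y) : L.legendre y (mapOf σ Γ y p) = p := by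
  rw [mapOf, hL.legendre_add _ (Γ y), hΓ, zero_add, hσL y _ p hp]

/-- The smooth coordinate expression of `σ`. -/
structure IsBundleMapExpr (σ : ∀ y : Y, Mom π y →L[ℝ] Sold π y) (c : FibredChart n m π.proj)
    (S : E n × E m → CoMom n m →L[ℝ] Vel n m) : Prop where
  contDiffOn : ContDiffOn ℝ ∞ S c.total.target
  soldCoord_eq : ∀ y ∈ c.total.source, ∀ (p : Mom π y) (P : CoMom n m), c.IsMomCoord p P →
      c.soldCoord (σ y p) = S (c.total y) P

lemma jetCoord_mapOf {S : E n × E m → CoMom n m →L[ℝ] Vel n m} (hS : IsBundleMapExpr σ c S)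
    (Γ : ∀ y : Y, Jet π y) {y : Y} (hy : y ∈ c.total.source) {p : Mom π y} {P : CoMom n m}
    (hP : c.IsMomCoord p P) :
    c.jetCoord (mapOf σ Γ y p)
      = c.jetCoord (Γ (c.total.symm (c.total y))) + S (c.total y) P := by
  rw [mapOf, jetCoord_add, hS.soldCoord_eq y hy p P hP, c.total.left_inv hy]

/-- The coordinate expression of `H_{σΓ}`. -/
lemma hamForm_isCoordExpr {ℓ : E n × E m → Vel n m → ℝ} (hℓ : L.IsCoordExpr c ℓ)
    {S : E n × E m → CoMom n m →L[ℝ] Vel n m} (hS : IsBundleMapExpr σ c S)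
    (Γ : ∀ y : Y, Jet π y) :
    (hamForm L σ Γ).IsCoordExpr c
      (coordHam ℓ (fun z P => c.jetCoord (Γ (c.total.symm z)) + S z P)) :=
  formOfMap_isCoordExpr hℓ fun _ hy _ _ hP => jetCoord_mapOf hS Γ hy hP

lemma isHamiltonianForm_hamForm (hL : L.IsQuadratic) (hσ : IsSmoothBundleMap σ)
    (hΓ : IsConnection Γ) : IsHamiltonianForm (hamForm L σ Γ) := by
  intro c
  obtain ⟨a, b, c₀, h⟩ := hL.exists_isQuadraticExpr c
  obtain ⟨S, hS1, hS2⟩ := hσ c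
  refine ⟨_, ?_, hamForm_isCoordExpr h.isCoordExpr ⟨hS1, hS2⟩ Γ⟩
  have hm : Set.MapsTo (fun q : (E n × E m) × CoMom n m => q.1)
    (c.total.target ×ˢ Set.univ) c.total.target := fun q hq => hq.1
  have hfst : ContDiffOn ℝ ∞ (fun q : (E n × E m) × CoMom n m => q.1)
    (c.total.target ×ˢ Set.univ) := contDiffOn_fst
  have hsnd : ContDiffOn ℝ ∞ (fun q : (E n × E m) × CoMom n m => q.2)
    (c.total.target ×ˢ Set.univ) := contDiffOn_snd
  have hF : ContDiffOn ℝ ∞ (fun q : (E n × E m) × CoMom n m =>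
      c.jetCoord (Γ (c.total.symm q.1)) + S q.1 q.2) (c.total.target ×ˢ Set.univ) :=
    ((hΓ c).comp hfst hm).add ((hS1.comp hfst hm).clm_apply hsnd)
  exact (hsnd.clm_apply hF).sub (h.contDiffOn.comp (hfst.prodMk hF) fun q hq => ⟨hq.1, trivial⟩)

/-- The Hamiltonian map of `H_{σΓ}` at `p` is `Φ(p) + w`, where `Φ = Γ + σ` and `w` is the transpose
of `σ` applied to `p - L̂(Φ(p))`. -/
lemma isHamiltonianMapOf_hamForm (hL : L.IsQuadratic) (hσ : IsSmoothBundleMap σ)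
    (W : ∀ y : Y, Mom π y → Sold π y)
    (hW : ∀ y p (q : Mom π y), q (W y p) = (p - L.legendre y (mapOf σ Γ y p)) (σ y q)) :
    IsHamiltonianMapOf (hamForm L σ Γ) (fun y p => (mapOf σ Γ y p).add (W y p)) := by
  intro c 𝓗 h𝓗 y hy p P hP Q
  obtain ⟨a, b, c₀, h⟩ := hL.exists_isQuadraticExpr c
  obtain ⟨S, hS1, hS2⟩ := hσ c
  have hS : IsBundleMapExpr σ c S := ⟨hS1, hS2⟩
  have hz := c.total.map_source hy
  rw [h𝓗.unique (hamForm_isCoordExpr h.isCoordExpr hS Γ) hz,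
    (hasFDerivAt_coordHam (h.hasFDerivAt hz _)).fderiv, ← jetCoord_mapOf hS Γ hy hP, jetCoord_add]
  have hQ := isMomCoord_momOfCoord (c := c) (π := π) hy Q
  have h1 := congrArg (fun η : Dens n => η (c.frame (π.proj y))) (hW y p (momOfCoord hy Q))
  simp only [sub_apply, ContinuousAlternatingMap.sub_apply] at h1
  rw [hQ, hP, h.isMomCoord_legendre hy, hS2 y hy _ _ hQ] at h1
  simp only [map_add, h1, add_apply, ContinuousLinearMap.apply_apply,
    ContinuousLinearMap.comp_apply, sub_apply]

/-- The transpose correction to `Φ` vanishes on the constraint space, because `L̂(Φ(p)) = p` there. -/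
lemma isWeaklyAssociated_hamForm (hL : L.IsQuadratic) (hσ : IsSmoothBundleMap σ)
    (hσL : IsSectionOnConstraints L σ) (hΓ : IsConnection Γ)
    (hΓL : ∀ y, L.legendre y (Γ y) = 0) : IsWeaklyAssociated L (hamForm L σ Γ) := by
  choose W hW using fun (y : Y) (p : Mom π y) =>
    exists_transpose (σ y) (p - L.legendre y (mapOf σ Γ y p))
  have hWp : ∀ (y : Y), ∀ p ∈ L.constraintSpace y,
      (mapOf σ Γ y p).add (W y p) = mapOf σ Γ y p := by
    intro y p hp
    obtain ⟨c, hy⟩ := π.exists_chart y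
    have h0 : c.soldCoord (W y p) = 0 := by
      refine (SeparatingDual.eq_zero_iff_forall_dual_eq_zero (R := ℝ) _).2 fun Q => ?_
      rw [← isMomCoord_momOfCoord hy Q (W y p), hW, hσL.legendre_mapOf hL hΓL hp, sub_self]
      rfl
    refine c.jetCoord_injective hy ?_
    rw [jetCoord_add, h0, add_zero]
  refine ⟨isHamiltonianForm_hamForm hL hσ hΓ, _, isHamiltonianMapOf_hamForm hL hσ W hW, ?_, ?_⟩
  · intro y v
    have hp : L.legendre y v ∈ L.constraintSpace y := ⟨v, rfl⟩
    change L.legendre y ((mapOf σ Γ y (L.legendre y v)).add (W y (L.legendre y v))) = _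
    rw [hWp y _ hp, hσL.legendre_mapOf hL hΓL hp]
  · intro y p hp
    ext1 v
    simp only [hamForm, formOfMap, hWp y p hp]

end Weak

/-! ### Change of fibred coordinates -/

section Transition

variable {F M : Type*} [NormedAddCommGroup F] [NormedSpace ℝ F] [TopologicalSpace M]
  [ChartedSpace F M] {e e' : OpenPartialHomeomorph M F}

lemma contDiffAt_transition (he : e ∈ IsManifold.maximalAtlas 𝓘(ℝ, F) ∞ M)
    (he' : e' ∈ IsManifold.maximalAtlas 𝓘(ℝ, F) ∞ M) {x : M} (hx : x ∈ e.source)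
    (hx' : x ∈ e'.source) : ContDiffAt ℝ ∞ (e' ∘ e.symm) (e x) := by
  rw [← contMDiffAt_iff_contDiffAt]
  refine ContMDiffAt.comp _ ?_ (contMDiffAt_symm_of_mem_maximalAtlas he (e.map_source hx))
  rw [e.left_inv hx]
  exact contMDiffAt_of_mem_maximalAtlas he' hx'

lemma fderiv_transition (he : e.MDifferentiable 𝓘(ℝ, F) 𝓘(ℝ, F))
    (he' : e'.MDifferentiable 𝓘(ℝ, F) 𝓘(ℝ, F)) {x : M} (hx : x ∈ e.source)
    (hx' : x ∈ e'.source) (u : F) :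
    fderiv ℝ (e' ∘ e.symm) (e x) u
      = mfderiv 𝓘(ℝ, F) 𝓘(ℝ, F) e' x (mfderiv 𝓘(ℝ, F) 𝓘(ℝ, F) e.symm (e x) u) := by
  have h1 : MDifferentiableAt 𝓘(ℝ, F) 𝓘(ℝ, F) e' (e.symm (e x)) := by
    rw [e.left_inv hx]
    exact he'.mdifferentiableAt hx'
  have h2 := mfderiv_comp (e x) h1 (he.mdifferentiableAt_symm (e.map_source hx))
  rw [e.left_inv hx, mfderiv_eq_fderiv] at h2
  exact DFunLike.congr_fun h2 u

end Transition

/-- Change of fibred coordinates of a jet, `y'^i_μ = (∂_λ + y^j_λ ∂_j) y'^i ∂x^λ / ∂x'^μ`. -/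
lemma jetCoord_change {y : Y} (hy : y ∈ c.total.source) (hy' : y ∈ c'.total.source)
    (v : Jet π y) :
    c'.jetCoord v = (ContinuousLinearMap.snd ℝ (E n) (E m)).comp
      ((fderiv ℝ (c'.total ∘ c.total.symm) (c.total y)).comp
        (((ContinuousLinearMap.id ℝ (E n)).prod (c.jetCoord v)).comp
          (fderiv ℝ (c.base ∘ c'.base.symm) (c'.base (π.proj y))))) := by
  have hx := c.proj_mem y hy
  have hx' := c'.proj_mem y hy'
  ext1 e
  have hβ : fderiv ℝ (c.base ∘ c'.base.symm) (c'.base (π.proj y)) e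
      = c.dbase (π.proj y) (c'.dbaseInv (π.proj y) e) :=
    fderiv_transition c'.mdifferentiable_base c.mdifferentiable_base hx' hx e
  have hτ : ∀ u, fderiv ℝ (c'.total ∘ c.total.symm) (c.total y) u
      = c'.dtotal y (c.dtotalInv y u) := fun u =>
    fderiv_transition c.mdifferentiable_total c'.mdifferentiable_total hy hy' u
  simp only [ContinuousLinearMap.comp_apply, ContinuousLinearMap.prod_apply, hτ, hβ,
    ContinuousLinearMap.id_apply, ContinuousLinearMap.coe_snd']
  rw [← dtotal_jet hy, dtotalInv_dtotal hy, dbaseInv_dbase hx]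
  rfl

/-- Smoothness at a point of a section of `J¹Y → Y` does not depend on the fibred coordinates. -/
lemma contDiffAt_jetCoord_change [IsManifold 𝓘(ℝ, E n) ∞ X] [IsManifold 𝓘(ℝ, E n × E m) ∞ Y]
    {Γ : ∀ y : Y, Jet π y} {y : Y} (hy : y ∈ c.total.source) (hy' : y ∈ c'.total.source)
    (h : ContDiffAt ℝ ∞ (fun z => c.jetCoord (Γ (c.total.symm z))) (c.total y)) :
    ContDiffAt ℝ ∞ (fun z => c'.jetCoord (Γ (c'.total.symm z))) (c'.total y) := by
  have hτ' : ContDiffAt ℝ ∞ (c.total ∘ c'.total.symm) (c'.total y) :=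
    contDiffAt_transition c'.total_mem c.total_mem hy' hy
  have hpt : (c.total ∘ c'.total.symm) (c'.total y) = c.total y := by
    simp [c'.total.left_inv hy']
  have hτ : ContDiffAt ℝ ∞ (fun z => fderiv ℝ (c'.total ∘ c.total.symm)
      ((c.total ∘ c'.total.symm) z)) (c'.total y) := by
    refine ContDiffAt.comp (c'.total y) ?_ hτ'
    rw [hpt]
    exact (contDiffAt_transition c.total_mem c'.total_mem hy hy').fderiv_right (by simp)
  have hβ : ContDiffAt ℝ ∞ (fun z : E n × E m => fderiv ℝ (c.base ∘ c'.base.symm) z.1)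
      (c'.total y) := by
    refine ContDiffAt.comp (c'.total y) ?_ contDiffAt_fst
    rw [c'.fst_total y hy']
    exact (contDiffAt_transition c'.base_mem c.base_mem (c'.proj_mem y hy')
      (c.proj_mem y hy)).fderiv_right (by simp)
  have hA : ContDiffAt ℝ ∞ (fun z => c.jetCoord (Γ (c.total.symm ((c.total ∘ c'.total.symm) z))))
      (c'.total y) := by
    refine ContDiffAt.comp (g := fun z => c.jetCoord (Γ (c.total.symm z))) (c'.total y) ?_ hτ'
    rwa [hpt]
  have hid : ContDiffAt ℝ ∞ (fun z => (ContinuousLinearMap.id ℝ (E n)).prod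
      (c.jetCoord (Γ (c.total.symm ((c.total ∘ c'.total.symm) z))))) (c'.total y) := by
    have h1 : ContDiffAt ℝ ∞ (fun z => ContinuousLinearMap.inl ℝ (E n) (E m)
        + (ContinuousLinearMap.inr ℝ (E n) (E m)).comp
          (c.jetCoord (Γ (c.total.symm ((c.total ∘ c'.total.symm) z))))) (c'.total y) :=
      contDiffAt_const.add (contDiffAt_const.clm_comp hA)
    refine h1.congr_of_eventuallyEq (Filter.Eventually.of_forall fun z => ?_)
    ext1 e
    simp
  refine ((contDiffAt_const (c := ContinuousLinearMap.snd ℝ (E n) (E m))).clm_comp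
    (hτ.clm_comp (hid.clm_comp hβ))).congr_of_eventuallyEq ?_
  have hU : c'.total.symm ⁻¹' c.total.source ∩ c'.total.target ∈ 𝓝 (c'.total y) := by
    refine Filter.inter_mem ?_ (c'.total.open_target.mem_nhds (c'.total.map_source hy'))
    refine (c'.total.continuousAt_symm (c'.total.map_source hy')).preimage_mem_nhds ?_
    rw [c'.total.left_inv hy']
    exact c.total.open_source.mem_nhds hy
  filter_upwards [hU] with z hz
  have hw' := c'.total.map_target hz.2
  rw [jetCoord_change hz.1 hw', ← c'.fst_total _ hw', c'.total.right_inv hz.2,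
    Function.comp_apply, c.total.left_inv hz.1]

/-! ### Jet prolongation of a section -/

lemma mdifferentiableAt_proj (π : FibredManifold n m X Y) (y : Y) :
    MDifferentiableAt 𝓘(ℝ, E n × E m) 𝓘(ℝ, E n) π.proj y := by
  obtain ⟨c, hy⟩ := π.exists_chart y
  have hb : MDifferentiableAt 𝓘(ℝ, E n) 𝓘(ℝ, E n) c.base.symm (c.total y).1 := by
    rw [c.fst_total y hy]
    exact c.mdifferentiable_base.mdifferentiableAt_symm (c.base.map_source (c.proj_mem y hy))
  have hf : MDifferentiableAt 𝓘(ℝ, E n × E m) 𝓘(ℝ, E n) (Prod.fst : E n × E m → E n)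
      (c.total y) := differentiableAt_fst.mdifferentiableAt
  exact (hb.comp y (hf.comp y (c.mdifferentiable_total.mdifferentiableAt hy))).congr_of_eventuallyEq
    (proj_eventuallyEq hy)

namespace IsSmoothSection

variable {s : X → Y}

/-- The jet prolongation `J¹s` of a section `s`. -/
def jet (hs : IsSmoothSection π s) (x : X) : Jet π (s x) :=
  ⟨mfderiv 𝓘(ℝ, E n) 𝓘(ℝ, E n × E m) s x, by
    have h1 := mfderiv_comp x (mdifferentiableAt_proj π (s x))
      ((hs.1 x).mdifferentiableAt (by simp))
    have h2 : π.proj ∘ s = id := funext hs.2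
    rw [h2, mfderiv_id] at h1
    exact h1.symm⟩

lemma eventually_mem (hs : IsSmoothSection π s) {x : X} (hx : s x ∈ c.total.source) :
    ∀ᶠ z in 𝓝 (c.base x), z ∈ c.base.target ∧ s (c.base.symm z) ∈ c.total.source := by
  have hxb : x ∈ c.base.source := by simpa [hs.2] using c.proj_mem _ hx
  refine Filter.Eventually.and (c.base.open_target.mem_nhds (c.base.map_source hxb)) ?_
  refine (hs.1.continuous.continuousAt.comp
    (c.base.continuousAt_symm (c.base.map_source hxb))).preimage_mem_nhds ?_
  simp only [Function.comp_apply, c.base.left_inv hxb]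
  exact c.total.open_source.mem_nhds hx

lemma total_eq (hs : IsSmoothSection π s) {x : X} (hx : s x ∈ c.total.source) :
    c.total (s x) = (c.base x, c.localRep s (c.base x)) := by
  have hxb : x ∈ c.base.source := by simpa [hs.2] using c.proj_mem _ hx
  refine Prod.ext ?_ ?_
  · rw [c.fst_total _ hx, hs.2]
  · simp [localRep, c.base.left_inv hxb]

lemma contDiffAt_localRep [IsManifold 𝓘(ℝ, E n) ∞ X] [IsManifold 𝓘(ℝ, E n × E m) ∞ Y]
    (hs : IsSmoothSection π s) {x : X} (hx : s x ∈ c.total.source) :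
    ContDiffAt ℝ ∞ (c.localRep s) (c.base x) := by
  have hxb : x ∈ c.base.source := by simpa [hs.2] using c.proj_mem _ hx
  have h1 := contMDiffAt_symm_of_mem_maximalAtlas c.base_mem (c.base.map_source hxb)
  have h2 : ContMDiffAt 𝓘(ℝ, E n) 𝓘(ℝ, E n × E m) ∞ (c.total ∘ s ∘ c.base.symm) (c.base x) := by
    refine ContMDiffAt.comp _ ?_ ((hs.1 _).comp _ h1)
    simp only [Function.comp_apply, c.base.left_inv hxb]
    exact contMDiffAt_of_mem_maximalAtlas c.total_mem hx
  exact (contMDiffAt_iff_contDiffAt.1 h2).snd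

lemma jetCoord_jet (hs : IsSmoothSection π s) {x : X} (hx : s x ∈ c.total.source) :
    c.jetCoord (hs.jet x) = fderiv ℝ (c.localRep s) (c.base x) := by
  have hxb : x ∈ c.base.source := by simpa [hs.2] using c.proj_mem _ hx
  have h1 := (c.mdifferentiable_base.mdifferentiableAt_symm (c.base.map_source hxb)).hasMFDerivAt
  have h2 : HasMFDerivAt 𝓘(ℝ, E n) 𝓘(ℝ, E n × E m) s (c.base.symm (c.base x))
      (mfderiv 𝓘(ℝ, E n) 𝓘(ℝ, E n × E m) s x) := by
    rw [c.base.left_inv hxb]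
    exact ((hs.1 x).mdifferentiableAt (by simp)).hasMFDerivAt
  have h3 : HasMFDerivAt 𝓘(ℝ, E n × E m) 𝓘(ℝ, E n × E m) c.total (s (c.base.symm (c.base x)))
      (mfderiv 𝓘(ℝ, E n × E m) 𝓘(ℝ, E n × E m) c.total (s x)) := by
    rw [c.base.left_inv hxb]
    exact (c.mdifferentiable_total.mdifferentiableAt hx).hasMFDerivAt
  have h4 := (h3.comp (c.base x) (h2.comp (c.base x) h1)).hasFDerivAt
  have h5 := ((ContinuousLinearMap.snd ℝ (E n) (E m)).hasFDerivAt.comp (c.base x) h4).fderiv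
  refine Eq.trans ?_ h5.symm
  ext1 e
  simp only [jetCoord, hs.2]
  rfl

end IsSmoothSection

/-! ### Connections extending a section -/

lemma nonempty_jet (y : Y) : Nonempty (Jet π y) := by
  obtain ⟨c, hy⟩ := π.exists_chart y
  exact ⟨jetOfCoord hy 0⟩

/-- A family of jets with prescribed coordinates in a chart; outside the chart the jets are
arbitrary. -/
lemma exists_jet_family (c : FibredChart n m π.proj) (A : E n × E m → Vel n m) :
    ∃ Γ : ∀ y : Y, Jet π y, ∀ y ∈ c.total.source, c.jetCoord (Γ y) = A (c.total y) := by
  classical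
  refine ⟨fun y => if hy : y ∈ c.total.source then jetOfCoord hy (A (c.total y))
    else (nonempty_jet y).some, fun y hy => ?_⟩
  simp [hy]

lemma contDiffAt_jet_family {c : FibredChart n m π.proj} {A : E n × E m → Vel n m}
    {Γ : ∀ y : Y, Jet π y} (hΓ : ∀ y ∈ c.total.source, c.jetCoord (Γ y) = A (c.total y))
    {y : Y} (hy : y ∈ c.total.source) (hA : ContDiffAt ℝ ∞ A (c.total y)) :
    ContDiffAt ℝ ∞ (fun z => c.jetCoord (Γ (c.total.symm z))) (c.total y) := by
  refine hA.congr_of_eventuallyEq ?_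
  filter_upwards [c.total.open_target.mem_nhds (c.total.map_source hy)] with z hz
  rw [hΓ _ (c.total.map_target hz), c.total.right_inv hz]

/-- Around every point of `Y` there is a smooth local connection which restricts to `J¹s` on the
image of `s`. -/
lemma exists_local_extension [T2Space Y] [IsManifold 𝓘(ℝ, E n) ∞ X]
    [IsManifold 𝓘(ℝ, E n × E m) ∞ Y] {s : X → Y} (hs : IsSmoothSection π s) (y₀ : Y) :
    ∃ U : Set Y, IsOpen U ∧ y₀ ∈ U ∧ ∃ (c : FibredChart n m π.proj) (Γ : ∀ y : Y, Jet π y),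
      (∀ y ∈ U, y ∈ c.total.source ∧
        ContDiffAt ℝ ∞ (fun z => c.jetCoord (Γ (c.total.symm z))) (c.total y)) ∧
      ∀ x, s x ∈ U → Γ (s x) = hs.jet x := by
  obtain ⟨c, hy₀⟩ := π.exists_chart y₀
  have hcont : Continuous fun y => s (π.proj y) := hs.1.continuous.comp
    (continuous_iff_continuousAt.2 fun y => (mdifferentiableAt_proj π y).continuousAt)
  -- Near a point of `s(X)` the velocities of `s` are taken constant along the fibres; off the closed
  -- set `s(X) = {y | s (π y) = y}` the flat connection of any chart will do.
  by_cases h : s (π.proj y₀) = y₀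
  · obtain ⟨Γ, hΓ⟩ := exists_jet_family c (fun z => fderiv ℝ (c.localRep s) z.1)
    refine ⟨c.total.source ∩ (fun y => s (π.proj y)) ⁻¹' c.total.source,
      c.total.open_source.inter (c.total.open_source.preimage hcont), ⟨hy₀, by simpa [h]⟩,
      c, Γ, fun y hy => ⟨hy.1, contDiffAt_jet_family
        (A := fun z => fderiv ℝ (c.localRep s) z.1) hΓ hy.1 ?_⟩, fun x hx => ?_⟩
    · refine ContDiffAt.comp (c.total y) ?_ contDiffAt_fst
      rw [c.fst_total y hy.1]
      exact (hs.contDiffAt_localRep hy.2).fderiv_right (by simp)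
    · refine c.jetCoord_injective hx.1 ?_
      rw [hΓ _ hx.1, hs.jetCoord_jet hx.1, hs.total_eq hx.1]
  · obtain ⟨Γ, hΓ⟩ := exists_jet_family c (fun _ => 0)
    refine ⟨c.total.source ∩ {y | s (π.proj y) ≠ y},
      c.total.open_source.inter (isOpen_ne_fun hcont continuous_id), ⟨hy₀, h⟩,
      c, Γ, fun y hy => ⟨hy.1, contDiffAt_jet_family hΓ hy.1 contDiffAt_const⟩, fun x hx => ?_⟩
    exact absurd (by rw [hs.2]) hx.2

/-- Jets at a point may be averaged with weights of sum `1`. -/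
def jetSum {ι : Type*} {y : Y} (I : Finset ι) (ρ : ι → ℝ) (hρ : ∑ i ∈ I, ρ i = 1)
    (v : ι → Jet π y) : Jet π y :=
  ⟨∑ i ∈ I, ρ i • (v i).1, by
    have h : ∀ i, (dproj π y).comp (ρ i • (v i).1) = ρ i • ContinuousLinearMap.id ℝ (E n) := by
      intro i
      rw [ContinuousLinearMap.comp_smul, (v i).2]
    rw [ContinuousLinearMap.comp_finsetSum, Finset.sum_congr rfl fun i _ => h i,
      ← Finset.sum_smul, hρ, one_smul]⟩

lemma jetCoord_jetSum {ι : Type*} {y : Y} (I : Finset ι) (ρ : ι → ℝ) (hρ : ∑ i ∈ I, ρ i = 1)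
    (v : ι → Jet π y) : c.jetCoord (jetSum I ρ hρ v) = ∑ i ∈ I, ρ i • c.jetCoord (v i) := by
  ext1 e
  simp [jetCoord, jetSum]

/-- The jet prolongation of a global section extends to a connection. -/
lemma exists_connection_extending [T2Space Y] [SecondCountableTopology Y]
    [IsManifold 𝓘(ℝ, E n) ∞ X] [IsManifold 𝓘(ℝ, E n × E m) ∞ Y] {s : X → Y}
    (hs : IsSmoothSection π s) :
    ∃ Γ : ∀ y : Y, Jet π y, IsConnection Γ ∧ ∀ x, Γ (s x) = hs.jet x := by
  choose U hU hyU d Γ hΓ hΓs using exists_local_extension hs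
  have : LocallyCompactSpace Y := ChartedSpace.locallyCompactSpace (E n × E m) Y
  obtain ⟨ρ, hρ⟩ := SmoothPartitionOfUnity.exists_isSubordinate 𝓘(ℝ, E n × E m)
    isClosed_univ U hU (fun y _ => Set.mem_iUnion.2 ⟨y, hyU y⟩)
  refine ⟨fun y => jetSum (ρ.finsupport y) (fun i => ρ i y) (ρ.sum_finsupport y (Set.mem_univ y))
    (fun i => Γ i y), fun c z hz => ContDiffAt.contDiffWithinAt ?_, fun x => ?_⟩
  · obtain ⟨y, hy, rfl⟩ : ∃ y ∈ c.total.source, c.total y = z :=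
      ⟨_, c.total.map_target hz, c.total.right_inv hz⟩
    have hsum : ContDiffAt ℝ ∞ (fun z => ∑ i ∈ ρ.fintsupport y,
        ρ i (c.total.symm z) • c.jetCoord (Γ i (c.total.symm z))) (c.total y) := by
      refine ContDiffAt.sum fun i hi => ContDiffAt.fun_smul ?_ ?_
      · exact contMDiffAt_iff_contDiffAt.1 (((ρ i).contMDiff _).comp _
          (contMDiffAt_symm_of_mem_maximalAtlas c.total_mem (c.total.map_source hy)))
      · have hyi := hΓ i y (hρ i ((ρ.mem_fintsupport_iff y i).1 hi))
        exact contDiffAt_jetCoord_change hyi.1 hy hyi.2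
    refine hsum.congr_of_eventuallyEq ?_
    have hev : ∀ᶠ z in 𝓝 (c.total y),
        ρ.finsupport (c.total.symm z) ⊆ ρ.fintsupport y := by
      have ht : Filter.Tendsto c.total.symm (𝓝 (c.total y)) (𝓝 y) := by
        have h := c.total.continuousAt_symm (c.total.map_source hy)
        rwa [ContinuousAt, c.total.left_inv hy] at h
      exact ht.eventually (ρ.eventually_finsupport_subset y)
    filter_upwards [hev] with z hz
    rw [jetCoord_jetSum]
    refine Finset.sum_subset hz fun i _ hi => ?_
    have : ρ i (c.total.symm z) = 0 := by simpa [ρ.mem_finsupport] using hi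
    rw [this, zero_smul]
  · refine Subtype.ext ?_
    have h : ∀ i ∈ ρ.finsupport (s x), ρ i (s x) • (Γ i (s x)).1 = ρ i (s x) • (hs.jet x).1 := by
      intro i hi
      rw [hΓs i x (hρ i (subset_tsupport _ ((ρ.mem_finsupport _).1 hi)))]
    change ∑ i ∈ ρ.finsupport (s x), ρ i (s x) • (Γ i (s x)).1 = _
    rw [Finset.sum_congr rfl h, ← Finset.sum_smul, ρ.sum_finsupport _ (Set.mem_univ _), one_smul]

/-! ### Connections with values in `Ker L̂` -/

variable {L : Lagrangian π} {σ : ∀ y : Y, Mom π y →L[ℝ] Sold π y}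

/-- The correction `Γ - σ(L̂ Γ)` of a connection `Γ`; it takes values in `Ker L̂`. -/
def kerConnection (L : Lagrangian π) (σ : ∀ y : Y, Mom π y →L[ℝ] Sold π y)
    (Γ : ∀ y : Y, Jet π y) (y : Y) : Jet π y :=
  (Γ y).add (-σ y (L.legendre y (Γ y)))

set_option synthInstance.maxHeartbeats 200000 in
lemma legendre_kerConnection (hL : L.IsQuadratic) (hσL : IsSectionOnConstraints L σ)
    (Γ : ∀ y : Y, Jet π y) (y : Y) : L.legendre y (kerConnection L σ Γ y) = 0 := by
  rw [kerConnection, hL.legendre_add _ (Γ y), map_neg, hσL y _ _ ⟨Γ y, rfl⟩, add_neg_cancel]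

/-- Adding `σ(L̂ Γ)` to the corrected connection gives `Γ` back. -/
lemma mapOf_kerConnection (Γ : ∀ y : Y, Jet π y) (y : Y) :
    mapOf σ (kerConnection L σ Γ) y (L.legendre y (Γ y)) = Γ y := by
  refine Subtype.ext (ContinuousLinearMap.ext fun e => ?_)
  simp [mapOf, kerConnection, Jet.add]

lemma isConnection_kerConnection (hL : L.IsQuadratic) (hσ : IsSmoothBundleMap σ)
    {Γ : ∀ y : Y, Jet π y} (hΓ : IsConnection Γ) : IsConnection (kerConnection L σ Γ) := by
  intro c
  obtain ⟨a, b, c₀, h⟩ := hL.exists_isQuadraticExpr c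
  obtain ⟨S, hS1, hS2⟩ := hσ c
  refine ((hΓ c).sub (hS1.clm_apply ((h.contDiffOn_a.clm_apply (hΓ c)).add
    h.contDiffOn_b))).congr fun z hz => ?_
  have hy := c.total.map_target hz
  have hP := h.isMomCoord_legendre hy (Γ (c.total.symm z))
  have h1 := hS2 _ hy _ _ hP
  rw [c.total.right_inv hz] at h1
  have h2 : c.soldCoord (-σ _ (L.legendre _ (Γ (c.total.symm z))))
      = -c.soldCoord (σ _ (L.legendre _ (Γ (c.total.symm z)))) :=
    map_neg (soldCoordL hy) _
  rw [kerConnection, jetCoord_add, h2, h1, ← sub_eq_add_neg]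

/-! ### Solutions of the Hamilton equations -/

lemma divergence_congr {P P' : E n → CoMom n m} {z : E n} (h : P =ᶠ[𝓝 z] P') (w : E m) :
    divergence P z w = divergence P' z w := by
  refine Finset.sum_congr rfl fun l _ => ?_
  rw [Filter.EventuallyEq.fderiv_eq (h.mono fun z' hz' => by rw [hz'])]

section Solution

variable {s : X → Y} (hs : IsSmoothSection π s)
  {a : E n × E m → Vel n m →L[ℝ] Vel n m →L[ℝ] ℝ} {b : E n × E m → CoMom n m}
  {c₀ : E n × E m → ℝ}

/-- The section `L̂ ∘ J¹s` of the Legendre bundle. -/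
def legendreSection (L : Lagrangian π) (hs : IsSmoothSection π s) (x : X) : LegendreBundle π :=
  ⟨s x, L.legendre (s x) (hs.jet x)⟩

/-- The coordinate expression of `L̂ ∘ J¹s`. -/
def legendreRep (c : FibredChart n m π.proj) (a : E n × E m → Vel n m →L[ℝ] Vel n m →L[ℝ] ℝ)
    (b : E n × E m → CoMom n m) (s : X → Y) (z : E n) : CoMom n m :=
  a (z, c.localRep s z) (fderiv ℝ (c.localRep s) z) + b (z, c.localRep s z)

lemma isMomRep_legendreRep (h : L.IsQuadraticExpr c a b c₀) :
    c.IsMomRep (legendreSection L hs) (legendreRep c a b s) := by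
  intro x hx
  change s x ∈ c.total.source at hx
  have h1 := h.isMomCoord_legendre hx (hs.jet x)
  rwa [hs.jetCoord_jet hx, hs.total_eq hx] at h1

lemma isSmoothLegendreSection_legendreSection [IsManifold 𝓘(ℝ, E n) ∞ X]
    [IsManifold 𝓘(ℝ, E n × E m) ∞ Y] (hL : L.IsQuadratic) :
    IsSmoothLegendreSection (legendreSection L hs) := by
  refine ⟨hs, fun c => ?_⟩
  obtain ⟨a, b, c₀, h⟩ := hL.exists_isQuadraticExpr c
  refine ⟨_, ?_, isMomRep_legendreRep hs h⟩
  rintro _ ⟨x, hx : s x ∈ c.total.source, rfl⟩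
  have hr := hs.contDiffAt_localRep hx
  have hg : ContDiffAt ℝ ∞ (fun z => (z, c.localRep s z)) (c.base x) := contDiffAt_id.prodMk hr
  have ht : (c.base x, c.localRep s (c.base x)) ∈ c.total.target := by
    rw [← hs.total_eq hx]
    exact c.total.map_source hx
  have ha := h.contDiffOn_a.contDiffAt (c.total.open_target.mem_nhds ht)
  have hb := h.contDiffOn_b.contDiffAt (c.total.open_target.mem_nhds ht)
  exact (((ha.comp (c.base x) hg).clm_apply (hr.fderiv_right (by simp))).add
    (hb.comp (c.base x) hg)).contDiffWithinAt

/-- If `s` solves the Euler–Lagrange equations and the map `Φ = Γ + σ` sends `L̂ ∘ J¹s` to `J¹s`,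
then `L̂ ∘ J¹s` solves the Hamilton equations of `H_{σΓ}`. -/
lemma isHamiltonSolution_legendreSection [IsManifold 𝓘(ℝ, E n) ∞ X]
    [IsManifold 𝓘(ℝ, E n × E m) ∞ Y] (hL : L.IsQuadratic) (hσ : IsSmoothBundleMap σ)
    (hEL : L.IsEulerLagrangeSolution s) {Γ : ∀ y : Y, Jet π y} (hΓ : IsConnection Γ)
    (hΓs : ∀ x, mapOf σ Γ (s x) (L.legendre (s x) (hs.jet x)) = hs.jet x) :
    IsHamiltonSolution (hamForm L σ Γ) (legendreSection L hs) := by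
  refine ⟨isSmoothLegendreSection_legendreSection hs hL, ?_⟩
  intro c 𝓗 P h𝓗 hP x hx
  change s x ∈ c.total.source at hx
  change (∀ Q : CoMom n m, fderiv ℝ (𝓗 (c.total (s x))) (P (c.base x)) Q
      = Q (fderiv ℝ (c.localRep s) (c.base x))) ∧ ∀ w : E m, divergence P (c.base x) w
      = - fderiv ℝ (fun u => 𝓗 (c.base x, u) (P (c.base x))) (c.total (s x)).2 w
  obtain ⟨a, b, c₀, h⟩ := hL.exists_isQuadraticExpr c
  obtain ⟨S, hS1, hS2⟩ := hσ c
  have hS : IsBundleMapExpr σ c S := ⟨hS1, hS2⟩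
  have hrep := isMomRep_legendreRep hs h
  have hH := hamForm_isCoordExpr h.isCoordExpr hS Γ
  have hz := c.total.map_source hx
  have hPx : P (c.base x) = legendreRep c a b s (c.base x) := (hP x hx).unique hx (hrep x hx)
  -- In coordinates, `Φ` maps the momenta of `L̂ ∘ J¹s` to the velocities of `s`.
  have hF : c.jetCoord (Γ (c.total.symm (c.total (s x)))) + S (c.total (s x)) (P (c.base x))
      = fderiv ℝ (c.localRep s) (c.base x) := by
    rw [← jetCoord_mapOf hS Γ hx (hP x hx), ← hs.jetCoord_jet hx]
    exact congrArg c.jetCoord (hΓs x)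
  have hD : HasFDerivAt (fun A => 1 / 2 * a (c.total (s x)) A A + b (c.total (s x)) A
      + c₀ (c.total (s x))) (P (c.base x)) (c.jetCoord (Γ (c.total.symm (c.total (s x))))
        + S (c.total (s x)) (P (c.base x))) := by
    refine (h.hasFDerivAt hz _).congr_fderiv ?_
    rw [hF, hPx, legendreRep, hs.total_eq hx]
  constructor
  · intro Q
    rw [h𝓗.unique hH hz, (hasFDerivAt_coordHam hD).fderiv, hF]
    simp
  · intro w
    -- Both `P` and the momentum field in the Euler–Lagrange equation agree near the point with the
    -- coordinate expression of `L̂ ∘ J¹s`, so the divergences are equal.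
    have hPev : P =ᶠ[𝓝 (c.base x)] legendreRep c a b s := by
      filter_upwards [hs.eventually_mem hx] with z hz'
      have e1 := (hP _ hz'.2).unique hz'.2 (hrep _ hz'.2)
      rwa [c.base.right_inv hz'.1] at e1
    have hLev : legendreRep c a b s =ᶠ[𝓝 (c.base x)] fun z => fderiv ℝ
        (fun A => 1 / 2 * a (z, c.localRep s z) A A + b (z, c.localRep s z) A
          + c₀ (z, c.localRep s z)) (fderiv ℝ (c.localRep s) z) := by
      filter_upwards [hs.eventually_mem hx] with z hz'
      have e1 := hs.total_eq hz'.2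
      rw [c.base.right_inv hz'.1] at e1
      rw [(h.hasFDerivAt (e1 ▸ c.total.map_source hz'.2) _).fderiv]
      rfl
    rw [divergence_congr (hPev.trans hLev), ← hEL.2 c _ h.isCoordExpr x hx w, hs.total_eq hx]
    rw [hs.total_eq hx] at hz hD hF
    set u₀ := c.localRep s (c.base x)
    have hnhds : c.total.target ∈ 𝓝 (c.base x, u₀) := c.total.open_target.mem_nhds hz
    have hline : ContDiffAt ℝ ∞ (fun u : E m => (c.base x, u)) u₀ :=
      contDiffAt_const.prodMk contDiffAt_id
    have hHev : (fun u => 𝓗 (c.base x, u) (P (c.base x))) =ᶠ[𝓝 u₀] fun u =>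
        coordHam (fun z A => 1 / 2 * a z A A + b z A + c₀ z)
          (fun z P => c.jetCoord (Γ (c.total.symm z)) + S z P) (c.base x, u) (P (c.base x)) := by
      filter_upwards [hline.continuousAt.preimage_mem_nhds hnhds] with u hu
      rw [h𝓗.unique hH hu]
    -- It remains to see that `∂𝓗/∂y = -∂ℓ/∂y`, which is the envelope argument for `Φ`.
    have hΦ : ContDiffAt ℝ ∞ (fun u : E m => c.jetCoord (Γ (c.total.symm (c.base x, u)))
        + S (c.base x, u) (P (c.base x))) u₀ :=
      (((hΓ c).contDiffAt hnhds).comp u₀ hline).add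
        (((hS1.contDiffAt hnhds).comp u₀ hline).clm_apply contDiffAt_const)
    have hℓ : DifferentiableAt ℝ (Function.uncurry fun (u : E m) (A : Vel n m) =>
        1 / 2 * a (c.base x, u) A A + b (c.base x, u) A + c₀ (c.base x, u))
        (u₀, c.jetCoord (Γ (c.total.symm (c.base x, u₀))) + S (c.base x, u₀) (P (c.base x))) := by
      have h1 := h.contDiffOn.contDiffAt (x := ((c.base x, u₀),
        c.jetCoord (Γ (c.total.symm (c.base x, u₀))) + S (c.base x, u₀) (P (c.base x))))
        (prod_mem_nhds hnhds Filter.univ_mem)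
      have h2 : ContDiffAt ℝ ∞ (fun q : E m × Vel n m => ((c.base x, q.1), q.2))
          (u₀, c.jetCoord (Γ (c.total.symm (c.base x, u₀))) + S (c.base x, u₀) (P (c.base x))) :=
        (contDiffAt_const.prodMk contDiffAt_fst).prodMk contDiffAt_snd
      exact (h1.comp (u₀, _) h2).differentiableAt (by simp)
    have henv := fderiv_envelope (Φ := fun u => c.jetCoord (Γ (c.total.symm (c.base x, u)))
      + S (c.base x, u) (P (c.base x))) hℓ (hΦ.differentiableAt (by simp)) hD
    rw [hHev.fderiv_eq]
    simp only [coordHam]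
    rw [henv, hF, neg_apply, neg_neg]

end Solution

end Polysymplectic

end

theorem theorem5 {n m : ℕ} {X Y : Type*}
    [TopologicalSpace X] [T2Space X] [SecondCountableTopology X]
    [ChartedSpace (Polysymplectic.E n) X]
    [IsManifold 𝓘(ℝ, Polysymplectic.E n) ∞ X]
    [TopologicalSpace Y] [T2Space Y] [SecondCountableTopology Y]
    [ChartedSpace (Polysymplectic.E n × Polysymplectic.E m) Y]
    [IsManifold 𝓘(ℝ, Polysymplectic.E n × Polysymplectic.E m) ∞ Y]
    (π : Polysymplectic.FibredManifold n m X Y)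
    (L : Polysymplectic.Lagrangian π) (hquad : L.IsQuadratic) (hreg : L.HasConstantRank)
    (hzero : ∀ y : Y, (0 : Polysymplectic.Mom π y) ∈ L.constraintSpace y)
    (σ : ∀ y : Y, Polysymplectic.Mom π y →L[ℝ] Polysymplectic.Sold π y)
    (hσ : Polysymplectic.IsSmoothBundleMap σ)
    (hσL : Polysymplectic.IsSectionOnConstraints L σ) :
    Polysymplectic.IsCompleteSet L
      {H | ∃ Γ : ∀ y : Y, Polysymplectic.Jet π y, Polysymplectic.IsConnection Γ ∧
        (∀ y : Y, L.legendre y (Γ y) = 0) ∧ H = Polysymplectic.hamForm L σ Γ} := by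
  refine ⟨?_, fun s hEL => ?_⟩
  · rintro _ ⟨Γ, hΓ, hΓL, rfl⟩
    exact Polysymplectic.isWeaklyAssociated_hamForm hquad hσ hσL hΓ hΓL
  · obtain ⟨Γ, hΓ, hΓs⟩ := Polysymplectic.exists_connection_extending hEL.1
    have hK := Polysymplectic.isConnection_kerConnection hquad hσ hΓ
    refine ⟨_, ⟨Polysymplectic.kerConnection L σ Γ, hK,
      Polysymplectic.legendre_kerConnection hquad hσL Γ, rfl⟩,
      Polysymplectic.legendreSection L hEL.1, ?_, fun x => rfl⟩
    refine Polysymplectic.isHamiltonSolution_legendreSection hEL.1 hquad hσ hEL hK fun x => ?_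
    rw [← hΓs x, Polysymplectic.mapOf_kerConnection]
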